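/- Let $0<\alpha<2$, $\beta\in[-1,1]$, $\sigma>0$. Put $w(\alpha,x)=\tan(\pi\alpha/2)$ if $\alpha\neq1$ and $w(1,x)=-\frac2\pi\ln|x|$. Let $(\varepsilon_t)_{t\in\mathbb Z}$ be i.i.d. $\mathcal S(\alpha,\beta,\sigma,0)$ variables, i.e. $\mathbb E[e^{iu\varepsilon_t}]=\exp\{-\sigma^\alpha|u|^\alpha(1-i\beta\,\mathrm{sign}(u)\,w(\alpha,u))\}$ for all $u\in\mathbb R$. Let $(d_k)_{k\in\mathbb Z}$ be a real sequence that is not identically zero, such that - if $\alpha\ne1$ or $(\alpha,\beta)=(1,0)$: $\sum_{k}|d_k|^s<\infty$ for some $s\in(0,\alpha)\cap[0,1]$; - if $\alpha=1$ and $\beta\neq0$: $\sum_k|d_k|<\infty$ and $\sum_k|d_k|\,\big|\ln|d_k|\big|<\infty$ (with $0\,|\ln 0|=0$). Let $X_t=\sum_{k\in\mathbb Z}d_k\varepsilon_{t+k}$ and, for integers $m\ge0$, $h\ge1$, let $\boldsymbol X_t=(X_{t-m},\ldots,X_t,X_{t+1},\ldots,X_{t+h})$ and $\boldsymbol d_k=(d_{k+m},\ldots,d_k,d_{k-1},\ldots,d_{k-h})$.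 Let $\|\cdot\|_e$ be the Euclidean norm and $\|\cdot\|$ a seminorm on $\mathbb R^{m+h+1}$ such that $\|(x_{-m},\ldots,x_0,x_1,\ldots,x_h)\|=0$ if and only if $x_{-m}=\cdots=x_0=0$, and let $C^{\|\cdot\|}=\{s\in\mathbb R^{m+h+1}:\|s\|=1\}$. The vector $\boldsymbol X_t$ is called representable on $C^{\|\cdot\|}$ in the following cases. - If $\boldsymbol X_t$ is not symmetric (its law differs from that of $-\boldsymbol X_t$): there are a vector $\boldsymbol\mu\in\mathbb R^{m+h+1}$ and a Borel measure $\Gamma$ on $C^{\|\cdot\|}$ such that, for all $u$, $\int|\langle u,s\rangle|^\alpha\,\Gamma(ds)<\infty$ if $\alpha\neq1$, respectively $\int|\langle u,s\rangle|\,\big|\ln|\langle u,s\rangle|\big|\,\Gamma(ds)<\infty$ if $\alpha=1$, and $$\mathbb E\big[e^{i\langle u,\boldsymbol X_t\rangle}\big]=\exp\Big\{-\int_{C^{\|\cdot\|}}|\langle u,s\rangle|^\alpha\big(1-i\,\mathrm{sign}(\langle u,s\rangle)\,w(\alpha,\langle u,s\rangle)\big)\Gamma(ds)+i\langle u,\boldsymbol\mu\rangle\Big\}.$$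 - If $\boldsymbol X_t$ is symmetric: there is a symmetric Borel measure $\Gamma$ on $C^{\|\cdot\|}$ such that, for all $u$, $\int|\langle u,s\rangle|^\alpha\,\Gamma(ds)<\infty$ and $\mathbb E[e^{i\langle u,\boldsymbol X_t\rangle}]=\exp\{-\int_{C^{\|\cdot\|}}|\langle u,s\rangle|^\alpha\,\Gamma(ds)\}$. Consider the condition $$(\ast)\qquad \forall k\in\mathbb Z:\quad d_{k+m}=\cdots=d_k=0\ \Longrightarrow\ d_\ell=0\ \text{ for all } \ell\le k-1 .$$ (i) If $\alpha\neq1$, or $(\alpha,\beta)=(1,0)$, or $\boldsymbol X_t$ is symmetric, then $\boldsymbol X_t$ is representable on $C^{\|\cdot\|}$ if and only if $(\ast)$ holds. (ii) If $\alpha=1$, $\beta\ne0$ and $\boldsymbol X_t$ is not symmetric, then $\boldsymbol X_t$ is representable on $C^{\|\cdot\|}$ if and only if $(\ast)$ holds and $$\sum_{k\in\mathbb Z}\|\boldsymbol d_k\|_e\,\Big|\ln\big(\|\boldsymbol d_k\|/\|\boldsymbol d_k\|_e\big)\Big|<\infty ,$$ where the terms with $\boldsymbol d_k=\boldsymbol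 0$ are read as $0$. -/

import Mathlib

open MeasureTheory ProbabilityTheory

noncomputable section

/-- The function `w(α, x)`: `tan (π α / 2)` if `α ≠ 1`, and `-(2/π) ln |x|` if `α = 1`. -/
def stableW (α x : ℝ) : ℝ :=
  if α = 1 then -(2 / Real.pi) * Real.log |x| else Real.tan (Real.pi * α / 2)

/-- `|x|^α (1 - i b sign(x) w(α, x))`. -/
def stableExponent (α b x : ℝ) : ℂ :=
  ((|x| ^ α : ℝ) : ℂ) * (1 - Complex.I * ((b * Real.sign x * stableW α x : ℝ) : ℂ))

/-- The real random variables `ε t`, `t ∈ ℤ`, are i.i.d. with the stable law `S(α, β, σ, 0)`, which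
is given by its characteristic function. -/
structure IsStableNoise {Ω : Type*} [MeasurableSpace Ω] (P : Measure Ω) (α β σ : ℝ)
    (ε : ℤ → Ω → ℝ) : Prop where
  measurable : ∀ t, Measurable (ε t)
  indep : iIndepFun ε P
  law : ∀ t u, charFun (P.map (ε t)) u =
    Complex.exp (-(((σ ^ α : ℝ) : ℂ) * stableExponent α β u))

/-- Conditions on the coefficients of the moving average. In the case `α = 1`, `β ≠ 0`, the
summability of `|d k|` only rules out sequences that do not tend to `0`. -/
structure IsMACoeff (α β : ℝ) (d : ℤ → ℝ) : Prop where
  ne_zero : ∃ k, d k ≠ 0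
  summable_rpow : α ≠ 1 ∨ β = 0 →
    ∃ s : ℝ, 0 < s ∧ s < α ∧ s ≤ 1 ∧ Summable fun k => |d k| ^ s
  summable_log : α = 1 → β ≠ 0 →
    (Summable fun k => |d k|) ∧ Summable fun k => |d k| * |Real.log (|d k|)|

/-- The moving average `X t = ∑ₖ d k * ε (t + k)`. -/
def movingAverage {Ω : Type*} (d : ℤ → ℝ) (ε : ℤ → Ω → ℝ) (t : ℤ) (ω : Ω) : ℝ :=
  ∑' k : ℤ, d k * ε (t + k) ω

/-- The path `(X (t - m), …, X t, X (t + 1), …, X (t + h))`. -/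
def pathVector {Ω : Type*} (X : ℤ → Ω → ℝ) (m h : ℕ) (t : ℤ) (ω : Ω) :
    EuclideanSpace ℝ (Fin (m + h + 1)) :=
  WithLp.toLp 2 fun j => X (t - (m : ℤ) + ((j : ℕ) : ℤ)) ω

/-- The vector `(d (k + m), …, d k, d (k - 1), …, d (k - h))`. -/
def coeffVector (d : ℤ → ℝ) (m h : ℕ) (k : ℤ) : EuclideanSpace ℝ (Fin (m + h + 1)) :=
  WithLp.toLp 2 fun j => d (k + (m : ℤ) - ((j : ℕ) : ℤ))

/-- A measure on a vector space is symmetric if it is invariant under `x ↦ -x`. -/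
def IsSymmetricMeasure {E : Type*} [Neg E] [MeasurableSpace E] (μ : Measure E) : Prop :=
  μ.map (fun x => -x) = μ

/-- The unit cylinder of a seminorm. -/
def unitCylinder {n : ℕ} (p : Seminorm ℝ (EuclideanSpace ℝ (Fin n))) :
    Set (EuclideanSpace ℝ (Fin n)) :=
  {s | p s = 1}

/-- Representability on the unit cylinder, for a non-symmetric `α`-stable law. A Borel measure on
the cylinder is a Borel measure on the whole space that gives no mass to the complement. -/
def IsRepresentableAsymm {n : ℕ} (α : ℝ) (p : Seminorm ℝ (EuclideanSpace ℝ (Fin n)))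
    (law : Measure (EuclideanSpace ℝ (Fin n))) : Prop :=
  ∃ (Γ : Measure (EuclideanSpace ℝ (Fin n))) (μ₀ : EuclideanSpace ℝ (Fin n)),
    Γ (unitCylinder p)ᶜ = 0 ∧
    (α ≠ 1 → ∀ u, ∫⁻ s, ENNReal.ofReal (|inner ℝ u s| ^ α) ∂Γ < ⊤) ∧
    (α = 1 → ∀ u, ∫⁻ s, ENNReal.ofReal (|inner ℝ u s| * |Real.log (|inner ℝ u s|)|) ∂Γ < ⊤) ∧
    ∀ u, charFun law u =
      Complex.exp (-(∫ s, stableExponent α 1 (inner ℝ u s) ∂Γ) +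
        Complex.I * ((inner ℝ u μ₀ : ℝ) : ℂ))

/-- Representability on the unit cylinder, for a symmetric `α`-stable law. -/
def IsRepresentableSymm {n : ℕ} (α : ℝ) (p : Seminorm ℝ (EuclideanSpace ℝ (Fin n)))
    (law : Measure (EuclideanSpace ℝ (Fin n))) : Prop :=
  ∃ Γ : Measure (EuclideanSpace ℝ (Fin n)),
    Γ (unitCylinder p)ᶜ = 0 ∧
    IsSymmetricMeasure Γ ∧
    (∀ u, ∫⁻ s, ENNReal.ofReal (|inner ℝ u s| ^ α) ∂Γ < ⊤) ∧
    ∀ u, charFun law u = Complex.exp (-((∫ s, |inner ℝ u s| ^ α ∂Γ : ℝ) : ℂ))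

/-- Representability of an `α`-stable random vector, with the given law, on the unit cylinder of the
seminorm `p`. -/
def IsRepresentable {n : ℕ} (α : ℝ) (p : Seminorm ℝ (EuclideanSpace ℝ (Fin n)))
    (law : Measure (EuclideanSpace ℝ (Fin n))) : Prop :=
  (¬ IsSymmetricMeasure law → IsRepresentableAsymm α p law) ∧
    (IsSymmetricMeasure law → IsRepresentableSymm α p law)

/-- Whenever `d (k + m) = … = d k = 0`, all earlier coefficients vanish. -/
def NoInteriorGap (d : ℤ → ℝ) (m : ℕ) : Prop :=
  ∀ k : ℤ, (∀ i : ℤ, k ≤ i → i ≤ k + (m : ℤ) → d i = 0) → ∀ l : ℤ, l ≤ k - 1 → d l = 0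

end

open scoped Topology ENNReal InnerProductSpace

/-!
The modulus of the characteristic function of a stable series `∑ i, ξ i • c i` depends only on the
moments `∑ i, |⟪u, c i⟫| ^ α`, so any spectral measure `Γ` has the same absolute moments of order
`α` as the atomic measure with masses `σ ^ α` at the points `c i`.

If no nonzero `c i` lies in the kernel of `p`, moving each atom radially to the unit cylinder yields
a representing measure. For `α = 1` the exponent is not homogeneous, and the rescaling costs the
drift `∑ i, log (p (c i)) • c i`, which is where the logarithmic condition enters. In a symmetric
law the skewness can be discarded, because the characteristic function is then real at every
multiple of `u`.

Conversely, let `T` be the orthogonal projection along the kernel of `p`, so that `T s ≠ 0` for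
`Γ`-almost all `s`. As `R → ∞`, the second differences
`|R * x + y| ^ α + |R * x - y| ^ α - 2 * |R * x| ^ α` tend to `2 * |y| ^ α` if `x = 0`, and to `0`
otherwise. At `x = ⟪v, T s⟫` for generic `v` they show that no nonzero atom lies in the kernel. For
`α = 1` they equal `2 * max (|y| - |R * x|) 0`, whose sum over `R = 2 ^ i` is comparable to
`|y| * log (|y| / |x|)` up to a multiple of `|y|`. A Gaussian average over `v` bounds this sum under
`Γ`, because `‖T s‖` is bounded below on the cylinder, and the bound passes to the atoms.
-/

/-! ### Tails of stable laws on the line -/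

lemma stableExponent_re (α b x : ℝ) : (stableExponent α b x).re = |x| ^ α := by
  simp [stableExponent, Complex.mul_re]

lemma stableExponent_im (α b x : ℝ) :
    (stableExponent α b x).im = -(|x| ^ α * (b * Real.sign x * stableW α x)) := by
  simp [stableExponent, Complex.mul_im]

lemma re_exp_neg_mul_stableExponent (α b a t : ℝ) :
    (Complex.exp (-(a * stableExponent α b t))).re =
      Real.exp (-(a * |t| ^ α)) * Real.cos (a * (|t| ^ α * (b * Real.sign t * stableW α t))) := by
  rw [Complex.exp_re, Complex.neg_re, Complex.neg_im, Complex.re_ofReal_mul,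
    Complex.im_ofReal_mul, stableExponent_re, stableExponent_im, mul_neg, neg_neg]

lemma one_sub_exp_neg_mul_cos_le {x : ℝ} (hx : 0 ≤ x) (y : ℝ) :
    1 - Real.exp (-x) * Real.cos y ≤ x + y ^ 2 / 2 := by
  have h_cos := Real.one_sub_sq_div_two_le_cos (x := y)
  have h_exp := Real.add_one_le_exp (-x)
  have h_exp_le : Real.exp (-x) ≤ 1 := Real.exp_le_one_iff.2 (neg_nonpos.2 hx)
  nlinarith [Real.cos_le_one y, Real.exp_pos (-x)]

lemma mul_log_sq_le_four {t : ℝ} (ht : 0 < t) (ht₂ : t ≤ 2) : t * Real.log t ^ 2 ≤ 4 := by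
  rcases le_or_gt t 1 with h | h
  · have h_abs := (Real.abs_log_mul_self_rpow_lt t (1 / 2) ht h (by norm_num)).le
    have h_sq : (Real.log t * t ^ (1 / 2 : ℝ)) ^ 2 ≤ 2 ^ 2 := by
      rw [← sq_abs]
      exact pow_le_pow_left₀ (abs_nonneg _) (by linarith) 2
    rw [mul_pow, ← Real.sqrt_eq_rpow, Real.sq_sqrt ht.le] at h_sq
    linarith
  · have h_log : Real.log t ^ 2 ≤ 1 := by
      nlinarith [Real.log_le_sub_one_of_pos ht, Real.log_pos h]
    nlinarith

lemma exists_sq_rpow_mul_stableW_le {α : ℝ} (hα : 0 < α) :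
    ∃ K, 0 ≤ K ∧ ∀ t, 0 < t → t ≤ 2 → (t ^ α * stableW α t) ^ 2 ≤ K * t ^ α := by
  rcases eq_or_ne α 1 with rfl | hα₁
  · refine ⟨(2 / Real.pi) ^ 2 * 4, by positivity, fun t ht ht₂ => ?_⟩
    simp only [stableW, if_true, Real.rpow_one, abs_of_pos ht]
    calc (t * (-(2 / Real.pi) * Real.log t)) ^ 2
        = (2 / Real.pi) ^ 2 * (t * Real.log t ^ 2) * t := by ring
      _ ≤ (2 / Real.pi) ^ 2 * 4 * t := by gcongr; exact mul_log_sq_le_four ht ht₂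
  · refine ⟨2 ^ α * Real.tan (Real.pi * α / 2) ^ 2, by positivity, fun t ht ht₂ => ?_⟩
    simp only [stableW, if_neg hα₁]
    calc (t ^ α * Real.tan (Real.pi * α / 2)) ^ 2
        = t ^ α * Real.tan (Real.pi * α / 2) ^ 2 * t ^ α := by ring
      _ ≤ 2 ^ α * Real.tan (Real.pi * α / 2) ^ 2 * t ^ α := by gcongr

lemma exists_one_sub_re_exp_neg_mul_stableExponent_le {α a : ℝ} (hα : 0 < α) (ha : 0 ≤ a) (b : ℝ) :
    ∃ K, 0 ≤ K ∧ ∀ t, 0 < t → t ≤ 2 →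
      1 - (Complex.exp (-(a * stableExponent α b t))).re ≤ K * t ^ α := by
  obtain ⟨K, hK, h⟩ := exists_sq_rpow_mul_stableW_le hα
  refine ⟨a + (a * b) ^ 2 * K / 2, by positivity, fun t ht ht₂ => ?_⟩
  rw [re_exp_neg_mul_stableExponent, abs_of_pos ht, Real.sign_of_pos ht]
  refine (one_sub_exp_neg_mul_cos_le (by positivity) _).trans ?_
  nlinarith [mul_le_mul_of_nonneg_left (h t ht ht₂) (sq_nonneg (a * b))]

section Tail

variable {ν : Measure ℝ} [IsProbabilityMeasure ν]

lemma norm_integral_one_sub_charFun_le {r B : ℝ} (hr : 0 ≤ r)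
    (h : ∀ t, 0 < t → t ≤ r → 1 - (charFun ν t).re ≤ B) :
    ‖∫ t in -r..r, 1 - charFun ν t‖ ≤ 2 * B * r := by
  have h_int : ∀ x y : ℝ, IntervalIntegrable (fun t => 1 - charFun ν t) volume x y := fun _ _ =>
    intervalIntegrable_const.sub intervalIntegrable_charFun
  have h_fold : ∫ t in -r..r, 1 - charFun ν t =
      ∫ t in (0 : ℝ)..r, (1 - charFun ν (-t)) + (1 - charFun ν t) := by
    rw [intervalIntegral.integral_add (by simpa using (h_int 0 (-r)).comp_sub_left 0) (h_int 0 r),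
      intervalIntegral.integral_comp_neg (fun t => 1 - charFun ν t), neg_zero,
      intervalIntegral.integral_add_adjacent_intervals (h_int _ _) (h_int _ _)]
  have h_re : ∀ t, (1 - charFun ν (-t)) + (1 - charFun ν t) =
      ((2 * (1 - (charFun ν t).re) : ℝ) : ℂ) := fun t => by
    have h_conj := Complex.add_conj (charFun ν t)
    push_cast at h_conj ⊢
    rw [charFun_neg]
    linear_combination -h_conj
  rw [h_fold]
  refine (intervalIntegral.norm_integral_le_of_norm_le_const (C := 2 * B) fun t ht => ?_).trans_eq
    (by rw [sub_zero, abs_of_nonneg hr])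
  rw [Set.uIoc_of_le hr] at ht
  have h_le_one : (charFun ν t).re ≤ 1 := (Complex.re_le_norm _).trans (norm_charFun_le_one t)
  rw [h_re, Complex.norm_real, Real.norm_of_nonneg (by linarith)]
  linarith [h t ht.1 ht.2]

lemma measure_lt_abs_le_of_one_sub_re_charFun_le {α K : ℝ} (hα : 0 ≤ α) (hK : 0 ≤ K)
    (h : ∀ t, 0 < t → t ≤ 2 → 1 - (charFun ν t).re ≤ K * t ^ α) {r : ℝ} (hr : 1 ≤ r) :
    ν {x | r < |x|} ≤ ENNReal.ofReal (2 * K * 2 ^ α * r ^ (-α)) := by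
  have hr₀ : 0 < r := by linarith
  have hr₂ : 2 * r⁻¹ ≤ 2 := by linarith [inv_le_one_of_one_le₀ hr]
  have h_integral := norm_integral_one_sub_charFun_le (r := 2 * r⁻¹) (B := K * (2 * r⁻¹) ^ α)
    (by positivity) fun t ht htr => (h t ht (htr.trans hr₂)).trans (by gcongr)
  rw [← neg_mul] at h_integral
  rw [← ofReal_measureReal]
  apply ENNReal.ofReal_le_ofReal
  calc ν.real {x | r < |x|}
      ≤ 2⁻¹ * r * (2 * (K * (2 * r⁻¹) ^ α) * (2 * r⁻¹)) :=
        (measureReal_abs_gt_le_integral_charFun hr₀).trans (by gcongr)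
    _ = 2 * K * 2 ^ α * r ^ (-α) := by
        rw [Real.mul_rpow (by norm_num) (by positivity), Real.inv_rpow hr₀.le, Real.rpow_neg hr₀.le]
        field_simp

lemma lintegral_rpow_abs_lt_top {α K s : ℝ}
    (h : ∀ r, 1 ≤ r → ν {x | r < |x|} ≤ ENNReal.ofReal (K * r ^ (-α))) (hs : 0 < s) (hsα : s < α) :
    ∫⁻ x, ENNReal.ofReal (|x| ^ s) ∂ν < ∞ := by
  rw [lintegral_rpow_eq_lintegral_meas_lt_mul ν (ae_of_all _ fun x => abs_nonneg x)
    (by fun_prop) hs, ← Set.Ioc_union_Ioi_eq_Ioi (zero_le_one' ℝ)]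
  refine ENNReal.mul_lt_top ENNReal.ofReal_lt_top
    ((lintegral_union_le _ _ _).trans_lt (ENNReal.add_lt_top.2 ⟨?_, ?_⟩))
  · have h_int : IntegrableOn (fun t : ℝ => t ^ (s - 1)) (Set.Ioc 0 1) := by
      rw [← intervalIntegrable_iff_integrableOn_Ioc_of_le zero_le_one]
      exact intervalIntegral.intervalIntegrable_rpow' (by linarith)
    exact (lintegral_mono fun t => mul_le_of_le_one_left zero_le prob_le_one).trans_lt
      h_int.lintegral_lt_top
  · have h_int : IntegrableOn (fun t : ℝ => K * t ^ (s - 1 - α)) (Set.Ioi 1) :=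
      (integrableOn_Ioi_rpow_of_lt (by linarith) one_pos).const_mul K
    refine (setLIntegral_mono' measurableSet_Ioi fun t ht => ?_).trans_lt h_int.lintegral_lt_top
    have ht₀ : (0 : ℝ) < t := one_pos.trans ht
    calc ν {x | t < |x|} * ENNReal.ofReal (t ^ (s - 1))
        ≤ ENNReal.ofReal (K * t ^ (-α)) * ENNReal.ofReal (t ^ (s - 1)) := by
          gcongr; exact h t (le_of_lt ht)
      _ = ENNReal.ofReal (K * t ^ (s - 1 - α)) := by
          rw [← ENNReal.ofReal_mul' (by positivity), mul_assoc, ← Real.rpow_add ht₀]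
          ring_nf

lemma measure_lt_min_abs_mul_one_le {K : ℝ}
    (h : ∀ r, 1 ≤ r → ν {x | r < |x|} ≤ ENNReal.ofReal (K * r⁻¹)) {c t : ℝ} (hc : c ≠ 0)
    (ht : 0 < t) :
    ν {x | t < min |c * x| 1} ≤ (Set.Ioc 0 |c|).indicator 1 t +
      (Set.Ioc |c| 1).indicator (fun t => ENNReal.ofReal (K * |c| * t⁻¹)) t := by
  have hc₀ : 0 < |c| := abs_pos.2 hc
  rcases le_or_gt t |c| with htc | htc
  · rw [Set.indicator_of_mem (s := Set.Ioc 0 |c|) ⟨ht, htc⟩]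
    exact prob_le_one.trans le_self_add
  rcases le_or_gt t 1 with ht₁ | ht₁
  · rw [Set.indicator_of_mem (s := Set.Ioc |c| 1) ⟨htc, ht₁⟩]
    refine le_add_left ?_
    calc ν {x | t < min |c * x| 1}
        ≤ ν {x | t / |c| < |x|} := measure_mono fun x hx => by
          have h_lt : t < |c| * |x| := abs_mul c x ▸ (lt_min_iff.1 hx).1
          exact (div_lt_iff₀' hc₀).2 h_lt
      _ ≤ ENNReal.ofReal (K * (t / |c|)⁻¹) := h _ ((one_le_div₀ hc₀).2 htc.le)
      _ = ENNReal.ofReal (K * |c| * t⁻¹) := by rw [inv_div, div_eq_mul_inv, mul_assoc]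
  · have h_empty : {x | t < min |c * x| 1} = ∅ :=
      Set.eq_empty_of_forall_notMem fun x hx => (ht₁.trans (lt_min_iff.1 hx).2).false
    rw [h_empty, measure_empty]
    exact zero_le

lemma lintegral_Ioc_const_mul_inv {K c : ℝ} (hK : 0 ≤ K) (hc : 0 < c) (hc₁ : c ≤ 1) :
    ∫⁻ t in Set.Ioc c 1, ENNReal.ofReal (K * t⁻¹) = ENNReal.ofReal (K * |Real.log c|) := by
  have h_int : IntervalIntegrable (fun t : ℝ => K * t⁻¹) volume c 1 :=
    (intervalIntegral.intervalIntegrable_inv (fun t ht =>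
      (hc.trans_le (Set.uIcc_of_le hc₁ ▸ ht : t ∈ Set.Icc c 1).1).ne') continuousOn_id).const_mul _
  rw [← ofReal_integral_eq_lintegral_ofReal
      ((intervalIntegrable_iff_integrableOn_Ioc_of_le hc₁).1 h_int)
      ((ae_restrict_iff' measurableSet_Ioc).2 (ae_of_all _ fun t ht => by
        have := hc.trans ht.1
        positivity)),
    ← intervalIntegral.integral_of_le hc₁, intervalIntegral.integral_const_mul,
    integral_inv_of_pos hc one_pos, one_div, Real.log_inv,
    abs_of_nonpos (Real.log_nonpos hc.le hc₁)]

lemma lintegral_min_abs_mul_one_le {K : ℝ} (hK : 0 ≤ K)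
    (h : ∀ r, 1 ≤ r → ν {x | r < |x|} ≤ ENNReal.ofReal (K * r⁻¹)) (c : ℝ) :
    ∫⁻ x, ENNReal.ofReal (min |c * x| 1) ∂ν ≤
      ENNReal.ofReal (|c| + K * (|c| * |Real.log c|)) := by
  rcases eq_or_ne c 0 with rfl | hc
  · simp
  have hc₀ : 0 < |c| := abs_pos.2 hc
  rcases le_or_gt |c| 1 with hc₁ | hc₁
  · rw [lintegral_eq_lintegral_meas_lt ν
      (ae_of_all _ fun x => le_min (abs_nonneg _) zero_le_one) (by fun_prop)]
    calc ∫⁻ t in Set.Ioi 0, ν {x | t < min |c * x| 1}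
        ≤ ∫⁻ t, (Set.Ioc 0 |c|).indicator 1 t +
            (Set.Ioc |c| 1).indicator (fun t => ENNReal.ofReal (K * |c| * t⁻¹)) t :=
          (setLIntegral_mono' measurableSet_Ioi fun t ht =>
            measure_lt_min_abs_mul_one_le h hc ht).trans (setLIntegral_le_lintegral _ _)
      _ = ENNReal.ofReal |c| + ENNReal.ofReal (K * |c| * |Real.log c|) := by
          rw [lintegral_add_left (measurable_one.indicator measurableSet_Ioc),
            lintegral_indicator_one measurableSet_Ioc, Real.volume_Ioc, sub_zero,
            lintegral_indicator measurableSet_Ioc,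
            lintegral_Ioc_const_mul_inv (by positivity) hc₀ hc₁, Real.log_abs]
      _ = ENNReal.ofReal (|c| + K * (|c| * |Real.log c|)) := by
          rw [← ENNReal.ofReal_add (by positivity) (by positivity), mul_assoc]
  · calc ∫⁻ x, ENNReal.ofReal (min |c * x| 1) ∂ν
        ≤ ∫⁻ _, ENNReal.ofReal 1 ∂ν :=
          lintegral_mono fun x => ENNReal.ofReal_le_ofReal (min_le_right _ _)
      _ = ENNReal.ofReal 1 := by simp
      _ ≤ ENNReal.ofReal (|c| + K * (|c| * |Real.log c|)) := by
          apply ENNReal.ofReal_le_ofReal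
          have : 0 ≤ K * (|c| * |Real.log c|) := by positivity
          linarith

end Tail

/-! ### Random series -/

section Summability

variable {ι : Type*}

lemma summable_abs_rpow_of_le {x : ι → ℝ} {s r : ℝ} (hs : 0 < s) (hsr : s ≤ r)
    (h : Summable fun i => |x i| ^ s) : Summable fun i => |x i| ^ r := by
  refine Summable.of_norm_bounded_eventually h ?_
  filter_upwards [h.tendsto_cofinite_zero.eventually_le_const one_pos] with i hi
  have h_le_one : |x i| ≤ 1 := by
    by_contra! hx
    exact hi.not_gt (Real.one_lt_rpow hx hs)
  rw [Real.norm_of_nonneg (by positivity)]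
  exact Real.rpow_le_rpow_of_exponent_ge_of_imp (abs_nonneg _) h_le_one hsr
    fun _ h => absurd h (hs.trans_le hsr).ne'

lemma summable_of_summable_min_abs_one {x : ι → ℝ} (h : Summable fun i => min |x i| 1) :
    Summable x := by
  refine Summable.of_norm_bounded_eventually h ?_
  filter_upwards [h.tendsto_cofinite_zero.eventually_lt_const one_pos] with i hi
  rcases min_lt_iff.1 hi with h_lt | h_lt
  · rw [min_eq_left h_lt.le, Real.norm_eq_abs]
  · exact absurd h_lt (lt_irrefl _)

lemma min_one_le_rpow {x s : ℝ} (hx : 0 ≤ x) (hs : 0 < s) (hs₁ : s ≤ 1) : min x 1 ≤ x ^ s := by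
  rcases le_total x 1 with h | h
  · exact (min_le_left _ _).trans (Real.self_le_rpow_of_le_one hx h hs₁)
  · exact (min_le_right _ _).trans (Real.one_le_rpow h hs.le)

variable {Ω : Type*} [MeasurableSpace Ω] {P : Measure Ω} [Countable ι]

lemma ae_summable_of_tsum_lintegral_ne_top {f : ι → Ω → ℝ} (hf : ∀ i, Measurable (f i))
    (hf₀ : ∀ i ω, 0 ≤ f i ω) (h : ∑' i, ∫⁻ ω, ENNReal.ofReal (f i ω) ∂P ≠ ∞) :
    ∀ᵐ ω ∂P, Summable fun i => f i ω := by
  rw [← lintegral_tsum fun i => (hf i).ennreal_ofReal.aemeasurable] at h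
  filter_upwards [ae_lt_top' (AEMeasurable.tsum fun i => (hf i).ennreal_ofReal.aemeasurable) h]
    with ω hω
  refine (ENNReal.summable_toReal hω.ne).congr fun i => ?_
  rw [ENNReal.toReal_ofReal (hf₀ i ω)]

variable {ξ : ι → Ω → ℝ} {ν : Measure ℝ} {c : ι → ℝ}

lemma ae_summable_mul_of_tsum_lintegral_min_ne_top (hξ : ∀ i, Measurable (ξ i))
    (hν : ∀ i, P.map (ξ i) = ν) (h : ∑' i, ∫⁻ x, ENNReal.ofReal (min |c i * x| 1) ∂ν ≠ ∞) :
    ∀ᵐ ω ∂P, Summable fun i => c i * ξ i ω := by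
  have h_map : ∀ i, ∫⁻ ω, ENNReal.ofReal (min |c i * ξ i ω| 1) ∂P =
      ∫⁻ x, ENNReal.ofReal (min |c i * x| 1) ∂ν := fun i => by
    rw [← hν i, lintegral_map (by fun_prop) (hξ i)]
  filter_upwards [ae_summable_of_tsum_lintegral_ne_top (P := P)
    (f := fun i ω => min |c i * ξ i ω| 1) (fun i => by have := hξ i; fun_prop)
    (fun i ω => by positivity) (by simpa only [h_map] using h)] with ω hω
  exact summable_of_summable_min_abs_one hω

lemma ae_summable_mul_of_summable_rpow (hξ : ∀ i, Measurable (ξ i)) (hν : ∀ i, P.map (ξ i) = ν)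
    {s : ℝ} (hs : 0 < s) (hs₁ : s ≤ 1) (h_moment : ∫⁻ x, ENNReal.ofReal (|x| ^ s) ∂ν < ∞)
    (hc : Summable fun i => |c i| ^ s) : ∀ᵐ ω ∂P, Summable fun i => c i * ξ i ω := by
  refine ae_summable_mul_of_tsum_lintegral_min_ne_top hξ hν (ne_top_of_le_ne_top
    (b := ∑' i, ENNReal.ofReal (|c i| ^ s) * ∫⁻ x, ENNReal.ofReal (|x| ^ s) ∂ν) ?_
    (ENNReal.tsum_le_tsum fun i => ?_))
  · rw [ENNReal.tsum_mul_right]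
    exact ENNReal.mul_ne_top hc.tsum_ofReal_ne_top h_moment.ne
  · rw [← lintegral_const_mul _ (by fun_prop)]
    refine lintegral_mono fun x => ?_
    rw [← ENNReal.ofReal_mul (by positivity), ← Real.mul_rpow (abs_nonneg _) (abs_nonneg _),
      ← abs_mul]
    exact ENNReal.ofReal_le_ofReal (min_one_le_rpow (abs_nonneg _) hs hs₁)

lemma ae_summable_mul_of_summable_mul_log [IsProbabilityMeasure ν] (hξ : ∀ i, Measurable (ξ i))
    (hν : ∀ i, P.map (ξ i) = ν) {K : ℝ} (hK : 0 ≤ K)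
    (h_tail : ∀ r, 1 ≤ r → ν {x | r < |x|} ≤ ENNReal.ofReal (K * r⁻¹))
    (hc : Summable fun i => |c i|) (hc_log : Summable fun i => |c i| * |Real.log (c i)|) :
    ∀ᵐ ω ∂P, Summable fun i => c i * ξ i ω :=
  ae_summable_mul_of_tsum_lintegral_min_ne_top hξ hν (ne_top_of_le_ne_top
    (hc.add (hc_log.mul_left K)).tsum_ofReal_ne_top
    (ENNReal.tsum_le_tsum fun i => lintegral_min_abs_mul_one_le hK h_tail (c i)))

end Summability

section RandomSeries

variable {Ω E : Type*} [MeasurableSpace Ω] {P : Measure Ω}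
  [NormedAddCommGroup E] [MeasurableSpace E] [BorelSpace E] [SecondCountableTopology E]

lemma aemeasurable_of_ae_hasSum {ι : Type*} [Countable ι] {f : ι → Ω → E} {V : Ω → E}
    (hf : ∀ i, Measurable (f i))
    (hV : ∀ᵐ ω ∂P, HasSum (fun i => f i ω) (V ω)) : AEMeasurable V P :=
  aemeasurable_of_tendsto_metrizable_ae Filter.atTop
    (fun s => (Finset.measurable_fun_sum s fun i _ => hf i).aemeasurable) hV

variable [InnerProductSpace ℝ E]

lemma tendsto_charFun_map_of_ae_tendsto [IsFiniteMeasure P]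
    {κ : Type*} {l : Filter κ} [l.IsCountablyGenerated] {S : κ → Ω → E} {V : Ω → E}
    (hS : ∀ k, AEMeasurable (S k) P) (hV : AEMeasurable V P)
    (h : ∀ᵐ ω ∂P, Filter.Tendsto (fun k => S k ω) l (𝓝 (V ω))) (u : E) :
    Filter.Tendsto (fun k => charFun (P.map (S k)) u) l (𝓝 (charFun (P.map V) u)) := by
  have h_cont : Continuous fun x : E => Complex.exp (⟪x, u⟫_ℝ * Complex.I) := by fun_prop
  simp only [charFun_apply]
  rw [integral_map hV (by fun_prop)]
  simp only [integral_map (hS _) h_cont.aestronglyMeasurable]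
  refine tendsto_integral_filter_of_dominated_convergence (fun _ => 1)
    (.of_forall fun k => h_cont.comp_aestronglyMeasurable (hS k).aestronglyMeasurable)
    (.of_forall fun k => ae_of_all _ fun ω => (Complex.norm_exp_ofReal_mul_I _).le)
    (integrable_const _) ?_
  filter_upwards [h] with ω hω
  exact (h_cont.tendsto _).comp hω

lemma charFun_map_smul_const {X : Ω → ℝ} (hX : Measurable X) (c u : E) :
    charFun (P.map fun ω => X ω • c) u = charFun (P.map X) ⟪u, c⟫_ℝ := by
  rw [charFun_apply, charFun_apply_real, integral_map (by fun_prop) (by fun_prop),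
    integral_map (by fun_prop) (by fun_prop)]
  simp only [real_inner_smul_left, real_inner_comm c u, Complex.ofReal_mul, mul_comm]

variable {ι : Type*} {ξ : ι → Ω → ℝ} {c : ι → E} {V : Ω → E}

lemma charFun_map_sum_smul (hξ : ∀ i, Measurable (ξ i))
    (h_indep : iIndepFun ξ P) (s : Finset ι) (u : E) :
    charFun (P.map fun ω => ∑ i ∈ s, ξ i ω • c i) u =
      ∏ i ∈ s, charFun (P.map (ξ i)) ⟪u, c i⟫_ℝ := by
  have h_smul : iIndepFun (fun i ω => ξ i ω • c i) P :=
    h_indep.comp (fun i x => x • c i) fun i => by fun_prop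
  rw [congrFun ((h_smul.restrict s).charFun_map_fun_finsetSum_eq_prod
    fun i _ => ((hξ i).smul_const _).aemeasurable) u, Finset.prod_apply]
  exact Finset.prod_congr rfl fun i _ => charFun_map_smul_const (hξ i) (c i) u

lemma charFun_map_of_ae_hasSum [Countable ι] [IsProbabilityMeasure P] (hξ : ∀ i, Measurable (ξ i))
    (h_indep : iIndepFun ξ P) (hV : ∀ᵐ ω ∂P, HasSum (fun i => ξ i ω • c i) (V ω)) {u : E}
    {z : ι → ℂ} (hz : ∀ i, charFun (P.map (ξ i)) ⟪u, c i⟫_ℝ = Complex.exp (-z i))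
    (hz_sum : Summable z) : charFun (P.map V) u = Complex.exp (-∑' i, z i) := by
  have h_meas : ∀ i, Measurable fun ω => ξ i ω • c i := fun i => (hξ i).smul_const _
  refine tendsto_nhds_unique (tendsto_charFun_map_of_ae_tendsto
    (fun s => (Finset.measurable_fun_sum s fun i _ => h_meas i).aemeasurable)
    (aemeasurable_of_ae_hasSum h_meas hV) hV u) ?_
  simp only [charFun_map_sum_smul hξ h_indep, hz, ← Complex.exp_sum]
  exact (Complex.continuous_exp.tendsto _).comp hz_sum.hasSum.neg

end RandomSeries

section StableExponent

lemma norm_stableExponent_le (α b x : ℝ) :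
    ‖stableExponent α b x‖ ≤ |x| ^ α + |b| * (|x| ^ α * |stableW α x|) := by
  have h_sign : |Real.sign x| ≤ 1 := by
    rcases Real.sign_apply_eq x with h | h | h <;> simp [h]
  calc ‖stableExponent α b x‖ ≤ |(stableExponent α b x).re| + |(stableExponent α b x).im| :=
        Complex.norm_le_abs_re_add_abs_im _
    _ = |x| ^ α + |b| * (|x| ^ α * (|Real.sign x| * |stableW α x|)) := by
        rw [stableExponent_re, stableExponent_im, abs_neg, abs_mul, abs_mul, abs_mul,
          abs_of_nonneg (by positivity : 0 ≤ |x| ^ α)]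
        ring
    _ ≤ |x| ^ α + |b| * (|x| ^ α * (1 * |stableW α x|)) := by gcongr
    _ = |x| ^ α + |b| * (|x| ^ α * |stableW α x|) := by rw [one_mul]

lemma abs_rpow_one_mul_abs_stableW (x : ℝ) :
    |x| ^ (1 : ℝ) * |stableW 1 x| = 2 / Real.pi * (|x| * |Real.log x|) := by
  rw [stableW, if_pos rfl, Real.rpow_one, Real.log_abs, abs_mul, abs_neg,
    abs_of_pos (by positivity : 0 < 2 / Real.pi)]
  ring

lemma summable_stableExponent {ι : Type*} {α b : ℝ} {x : ι → ℝ}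
    (hx : Summable fun i => |x i| ^ α)
    (hx_log : α = 1 → b ≠ 0 → Summable fun i => |x i| * |Real.log (x i)|) :
    Summable fun i => stableExponent α b (x i) := by
  refine Summable.of_norm_bounded (hx.add ?_) fun i => norm_stableExponent_le α b (x i)
  rcases eq_or_ne b 0 with rfl | hb
  · simp [summable_zero]
  refine Summable.mul_left _ ?_
  rcases eq_or_ne α 1 with rfl | hα
  · simpa only [abs_rpow_one_mul_abs_stableW] using (hx_log rfl hb).mul_left (2 / Real.pi)
  · simpa only [stableW, hα, if_false] using hx.mul_right |Real.tan (Real.pi * α / 2)|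

end StableExponent

section SummableLog

lemma mul_abs_log_le {x y M : ℝ} (hx : 0 ≤ x) (hy : 0 ≤ y) (hM : 0 ≤ M) (hyx : y ≤ M * x) :
    y * |Real.log y| ≤ (1 + M ^ 2) * x + M * (x * |Real.log x|) := by
  rcases hy.eq_or_lt with rfl | hy
  · rw [zero_mul]
    positivity
  have hx : 0 < x := hx.lt_of_ne fun h => by simp [← h, hy.not_ge] at hyx
  obtain ⟨r, hr, rfl⟩ : ∃ r, 0 < r ∧ y = r * x := ⟨y / x, by positivity, by field_simp⟩
  have hrM : r ≤ M := le_of_mul_le_mul_right hyx hx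
  have h_log : r * |Real.log r| ≤ 1 + M ^ 2 := by
    rcases le_or_gt r 1 with h | h
    · have h_abs := Real.abs_log_mul_self_lt r hr h
      rw [abs_mul, abs_of_pos hr, mul_comm] at h_abs
      nlinarith
    · rw [abs_of_pos (Real.log_pos h)]
      nlinarith [Real.log_le_sub_one_of_pos hr]
  rw [Real.log_mul hr.ne' hx.ne']
  calc r * x * |Real.log r + Real.log x| ≤ r * x * (|Real.log r| + |Real.log x|) := by
        gcongr; exact abs_add_le _ _
    _ = r * |Real.log r| * x + r * (x * |Real.log x|) := by ring
    _ ≤ (1 + M ^ 2) * x + M * (x * |Real.log x|) := by gcongr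

lemma exists_norm_le_card_mul_abs {κ : Type*} [Fintype κ] [Nonempty κ] (x : EuclideanSpace ℝ κ) :
    ∃ j, ‖x‖ ≤ Fintype.card κ * |x j| := by
  classical
  obtain ⟨j, -, hj⟩ := Finset.exists_max_image Finset.univ (fun j => |x j|) Finset.univ_nonempty
  refine ⟨j, ?_⟩
  calc ‖x‖ = ‖∑ i, x i • EuclideanSpace.single i (1 : ℝ)‖ := by
        simpa using congrArg norm ((EuclideanSpace.basisFun κ ℝ).sum_repr x).symm
    _ ≤ ∑ i, |x i| := (norm_sum_le _ _).trans_eq (by simp [norm_smul])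
    _ ≤ Fintype.card κ * |x j| :=
        (Finset.sum_le_card_nsmul _ _ _ hj).trans_eq (by rw [nsmul_eq_mul, Finset.card_univ])

variable {ι κ : Type*} [Fintype κ] [Nonempty κ] {c : ι → EuclideanSpace ℝ κ}

lemma summable_norm_rpow_of_forall_apply {α : ℝ} (hα : 0 ≤ α)
    (h : ∀ j, Summable fun i => |c i j| ^ α) : Summable fun i => ‖c i‖ ^ α := by
  refine Summable.of_nonneg_of_le (fun i => by positivity) (fun i => ?_)
    ((summable_sum fun j (_ : j ∈ Finset.univ) => h j).mul_left ((Fintype.card κ : ℝ) ^ α))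
  obtain ⟨j, hj⟩ := exists_norm_le_card_mul_abs (c i)
  calc ‖c i‖ ^ α ≤ (Fintype.card κ * |c i j|) ^ α := by gcongr
    _ = (Fintype.card κ : ℝ) ^ α * |c i j| ^ α := Real.mul_rpow (by positivity) (abs_nonneg _)
    _ ≤ (Fintype.card κ : ℝ) ^ α * ∑ j, |c i j| ^ α := by
        gcongr
        exact Finset.single_le_sum (f := fun j => |c i j| ^ α) (fun _ _ => by positivity)
          (Finset.mem_univ j)

lemma summable_norm_mul_abs_log_of_forall_apply (h : ∀ j, Summable fun i => |c i j|)
    (h_log : ∀ j, Summable fun i => |c i j| * |Real.log (c i j)|) :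
    Summable fun i => ‖c i‖ * |Real.log ‖c i‖| := by
  refine Summable.of_nonneg_of_le (fun i => by positivity) (fun i => ?_)
    (summable_sum fun j (_ : j ∈ Finset.univ) =>
      ((h j).mul_left (1 + (Fintype.card κ : ℝ) ^ 2)).add ((h_log j).mul_left (Fintype.card κ : ℝ)))
  obtain ⟨j, hj⟩ := exists_norm_le_card_mul_abs (c i)
  refine (mul_abs_log_le (abs_nonneg _) (norm_nonneg _) (by positivity) hj).trans ?_
  rw [Real.log_abs]
  exact Finset.single_le_sum (f := fun j => (1 + (Fintype.card κ : ℝ) ^ 2) * |c i j| +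
    Fintype.card κ * (|c i j| * |Real.log (c i j)|)) (fun _ _ => by positivity) (Finset.mem_univ j)

end SummableLog

section StableSeries

/-- `law` has the characteristic function of the series `∑ i, ξ i • c i`, where the `ξ i` are
independent with law `S(α, β, a ^ (1 / α), 0)`, and the coefficients satisfy the summability
conditions under which its exponent converges absolutely. -/
structure IsStableSeriesLaw {ι E : Type*} [NormedAddCommGroup E] [InnerProductSpace ℝ E]
    [MeasurableSpace E] (α β a : ℝ) (c : ι → E) (law : Measure E) : Prop where
  summable_rpow : Summable fun i => ‖c i‖ ^ α
  summable_log : α = 1 → β ≠ 0 → Summable fun i => ‖c i‖ * |Real.log ‖c i‖|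
  charFun_eq : ∀ u, charFun law u = Complex.exp (-∑' i, a * stableExponent α β ⟪u, c i⟫_ℝ)

variable {ι E : Type*} [NormedAddCommGroup E] [InnerProductSpace ℝ E] {c : ι → E} {α : ℝ}

lemma summable_abs_inner_rpow (hα : 0 ≤ α) (hc : Summable fun i => ‖c i‖ ^ α) (u : E) :
    Summable fun i => |⟪u, c i⟫_ℝ| ^ α := by
  refine Summable.of_nonneg_of_le (fun i => by positivity) (fun i => ?_) (hc.mul_left (‖u‖ ^ α))
  rw [← Real.mul_rpow (norm_nonneg _) (norm_nonneg _)]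
  exact Real.rpow_le_rpow (abs_nonneg _) (abs_real_inner_le_norm _ _) hα

lemma summable_abs_inner_mul_log (hc : Summable fun i => ‖c i‖)
    (hc_log : Summable fun i => ‖c i‖ * |Real.log ‖c i‖|) (u : E) :
    Summable fun i => |⟪u, c i⟫_ℝ| * |Real.log ⟪u, c i⟫_ℝ| := by
  refine Summable.of_nonneg_of_le (fun i => by positivity) (fun i => ?_)
    ((hc.mul_left (1 + ‖u‖ ^ 2)).add (hc_log.mul_left ‖u‖))
  simpa only [Real.log_abs] using mul_abs_log_le (norm_nonneg _) (abs_nonneg _) (norm_nonneg _)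
    (abs_real_inner_le_norm u (c i))

variable [MeasurableSpace E] {β a : ℝ} {law : Measure E}

lemma IsStableSeriesLaw.summable_inner_log (h : IsStableSeriesLaw α β a c law) (hα : α = 1)
    (hβ : β ≠ 0) (u : E) : Summable fun i => |⟪u, c i⟫_ℝ| * |Real.log ⟪u, c i⟫_ℝ| :=
  summable_abs_inner_mul_log (by simpa [hα] using h.summable_rpow) (h.summable_log hα hβ) u

lemma IsStableSeriesLaw.summable_stableExponent_inner (h : IsStableSeriesLaw α β a c law)
    (hα : 0 ≤ α) (u : E) : Summable fun i => stableExponent α β ⟪u, c i⟫_ℝ :=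
  summable_stableExponent (summable_abs_inner_rpow hα h.summable_rpow u)
    fun hα₁ hβ => h.summable_inner_log hα₁ hβ u

end StableSeries

section Path

lemma IsMACoeff.summable_abs_rpow {α β : ℝ} {d : ℤ → ℝ} (hd : IsMACoeff α β d) :
    Summable fun k => |d k| ^ α := by
  by_cases h : α ≠ 1 ∨ β = 0
  · obtain ⟨s, hs, hsα, -, h_sum⟩ := hd.summable_rpow h
    exact summable_abs_rpow_of_le hs hsα.le h_sum
  · push Not at h
    simpa [h.1] using (hd.summable_log h.1 h.2).1

lemma summable_comp_coeffVector_apply {d : ℤ → ℝ} {g : ℝ → ℝ} (hg : Summable fun k => g (d k))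
    (m h : ℕ) (j : Fin (m + h + 1)) : Summable fun k => g (coeffVector d m h k j) := by
  rw [← (Equiv.addRight ((m : ℤ) - (j : ℕ))).summable_iff] at hg
  exact hg.congr fun k => by simp [coeffVector, add_sub_assoc]

variable {Ω : Type*} {ε : ℤ → Ω → ℝ} {d : ℤ → ℝ}

lemma hasSum_pathVector {m h : ℕ} {t : ℤ} {ω : Ω}
    (hω : ∀ τ : ℤ, Summable fun k => d k * ε (τ + k) ω) :
    HasSum (fun i => ε (i + t) ω • coeffVector d m h i)
      (pathVector (movingAverage d ε) m h t ω) := by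
  have h_coord : HasSum (fun i (j : Fin (m + h + 1)) => ε (i + t) ω * d (i + m - (j : ℕ)))
      (fun j => movingAverage d ε (t - (m : ℤ) + ((j : ℕ) : ℤ)) ω) := by
    refine Pi.hasSum.2 fun j => ?_
    have h_sum := (hω (t - (m : ℤ) + ((j : ℕ) : ℤ))).hasSum
    rw [← (Equiv.addRight ((m : ℤ) - (j : ℕ))).hasSum_iff] at h_sum
    refine h_sum.congr_fun fun i => ?_
    simp only [Function.comp, Equiv.coe_addRight]
    ring_nf
  exact (PiLp.continuousLinearEquiv 2 ℝ fun _ : Fin (m + h + 1) => ℝ).symm.hasSum.2 h_coord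

variable [MeasurableSpace Ω] {P : Measure Ω} [IsProbabilityMeasure P] {α β σ : ℝ}

lemma IsStableNoise.map_eq_map_zero (hε : IsStableNoise P α β σ ε) (t : ℤ) :
    P.map (ε t) = P.map (ε 0) := by
  have := Measure.isProbabilityMeasure_map (μ := P) (hε.measurable t).aemeasurable
  have := Measure.isProbabilityMeasure_map (μ := P) (hε.measurable 0).aemeasurable
  exact Measure.ext_of_charFun (funext fun u => by rw [hε.law, hε.law])

lemma IsStableNoise.exists_measure_lt_abs_le (hε : IsStableNoise P α β σ ε) (hα : 0 < α)
    (hσ : 0 ≤ σ) : ∃ K, 0 ≤ K ∧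
      ∀ r, 1 ≤ r → P.map (ε 0) {x | r < |x|} ≤ ENNReal.ofReal (K * r ^ (-α)) := by
  have := Measure.isProbabilityMeasure_map (μ := P) (hε.measurable 0).aemeasurable
  obtain ⟨K, hK, h⟩ :=
    exists_one_sub_re_exp_neg_mul_stableExponent_le hα (Real.rpow_nonneg hσ α) β
  exact ⟨2 * K * 2 ^ α, by positivity, fun r => measure_lt_abs_le_of_one_sub_re_charFun_le hα.le hK
    fun t => by simpa only [hε.law] using h t⟩

lemma IsStableNoise.ae_summable_mul (hε : IsStableNoise P α β σ ε) (hα : 0 < α) (hσ : 0 ≤ σ)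
    (hd : IsMACoeff α β d) (t : ℤ) : ∀ᵐ ω ∂P, Summable fun k => d k * ε (t + k) ω := by
  have := Measure.isProbabilityMeasure_map (μ := P) (hε.measurable 0).aemeasurable
  obtain ⟨K, hK, h_tail⟩ := hε.exists_measure_lt_abs_le hα hσ
  by_cases h : α ≠ 1 ∨ β = 0
  · obtain ⟨s, hs, hsα, hs₁, h_sum⟩ := hd.summable_rpow h
    exact ae_summable_mul_of_summable_rpow (fun k => hε.measurable (t + k))
      (fun k => hε.map_eq_map_zero (t + k)) hs hs₁ (lintegral_rpow_abs_lt_top h_tail hs hsα) h_sum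
  · push Not at h
    obtain ⟨rfl, hβ⟩ := h
    obtain ⟨h_sum, h_log⟩ := hd.summable_log rfl hβ
    exact ae_summable_mul_of_summable_mul_log (fun k => hε.measurable (t + k))
      (fun k => hε.map_eq_map_zero (t + k)) hK (by simpa only [Real.rpow_neg_one] using h_tail)
      h_sum (by simpa only [Real.log_abs] using h_log)

theorem isStableSeriesLaw_pathVector (hε : IsStableNoise P α β σ ε) (hd : IsMACoeff α β d)
    (hα : 0 < α) (hσ : 0 ≤ σ) (m h : ℕ) (t : ℤ) :
    IsStableSeriesLaw α β (σ ^ α) (coeffVector d m h)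
      (P.map (pathVector (movingAverage d ε) m h t)) := by
  have h_rpow : Summable fun k => ‖coeffVector d m h k‖ ^ α :=
    summable_norm_rpow_of_forall_apply hα.le
      (summable_comp_coeffVector_apply (g := fun x => |x| ^ α) hd.summable_abs_rpow m h)
  have h_log : α = 1 → β ≠ 0 →
      Summable fun k => ‖coeffVector d m h k‖ * |Real.log ‖coeffVector d m h k‖| := fun hα₁ hβ => by
    obtain ⟨h_sum, h_sum_log⟩ := hd.summable_log hα₁ hβ
    simp only [Real.log_abs] at h_sum_log
    exact summable_norm_mul_abs_log_of_forall_apply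
      (summable_comp_coeffVector_apply (g := fun x => |x|) h_sum m h)
      (summable_comp_coeffVector_apply (g := fun x => |x| * |Real.log x|) h_sum_log m h)
  refine ⟨h_rpow, h_log, fun u => ?_⟩
  have h_hasSum : ∀ᵐ ω ∂P, HasSum (fun i => ε (i + t) ω • coeffVector d m h i)
      (pathVector (movingAverage d ε) m h t ω) := by
    filter_upwards [ae_all_iff.2 fun τ => hε.ae_summable_mul hα hσ hd τ] with ω hω
    exact hasSum_pathVector hω
  refine charFun_map_of_ae_hasSum (fun i => hε.measurable (i + t))
    (hε.indep.precomp (add_left_injective t)) h_hasSum (fun i => by rw [hε.law]) ?_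
  exact (summable_stableExponent (summable_abs_inner_rpow hα.le h_rpow u) fun hα₁ hβ =>
    summable_abs_inner_mul_log (by simpa [hα₁] using h_rpow) (h_log hα₁ hβ) u).mul_left _

end Path

/-! ### Representing measures on the cylinder -/

section StableExponentScaling

lemma stableExponent_apply_zero {α : ℝ} (hα : α ≠ 0) (b : ℝ) : stableExponent α b 0 = 0 := by
  simp [stableExponent, Real.zero_rpow hα]

lemma stableExponent_zero_skewness (α x : ℝ) : stableExponent α 0 x = (|x| ^ α : ℝ) := by
  simp [stableExponent]

lemma stableExponent_mul_skewness (α β b x : ℝ) :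
    stableExponent α (β * b) x = ((1 + β) / 2 : ℝ) * stableExponent α b x +
      ((1 - β) / 2 : ℝ) * stableExponent α b (-x) := by
  simp only [stableExponent, abs_neg, Real.sign_neg, stableW]
  push_cast
  ring

/-- The logarithm of `r` if `α = 1`, and `0` otherwise. The exponents with `α = 1` are homogeneous
only up to a drift, which is proportional to this quantity. -/
noncomputable def logScale (α r : ℝ) : ℝ := if α = 1 then Real.log r else 0

lemma real_sign_mul_of_pos {r : ℝ} (hr : 0 < r) (x : ℝ) : Real.sign (r * x) = Real.sign x := by
  rcases lt_trichotomy x 0 with h | rfl | h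
  · rw [Real.sign_of_neg h, Real.sign_of_neg (mul_neg_of_pos_of_neg hr h)]
  · rw [mul_zero]
  · rw [Real.sign_of_pos h, Real.sign_of_pos (mul_pos hr h)]

lemma real_sign_mul_abs (x : ℝ) : Real.sign x * |x| = x := by
  rcases lt_trichotomy x 0 with h | rfl | h
  · rw [Real.sign_of_neg h, abs_of_neg h, neg_one_mul, neg_neg]
  · rw [abs_zero, mul_zero]
  · rw [Real.sign_of_pos h, abs_of_pos h, one_mul]

lemma stableExponent_pos_mul {α : ℝ} (hα : α ≠ 0) (b : ℝ) {r : ℝ} (hr : 0 < r) (x : ℝ) :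
    stableExponent α b (r * x) = (r ^ α : ℝ) *
      (stableExponent α b x + Complex.I * (2 / Real.pi * (b * logScale α r * x) : ℝ)) := by
  rcases eq_or_ne x 0 with rfl | hx
  · simp [stableExponent_apply_zero hα]
  have h_rpow : |r * x| ^ α = r ^ α * |x| ^ α := by
    rw [abs_mul, abs_of_pos hr, Real.mul_rpow hr.le (abs_nonneg _)]
  rcases eq_or_ne α 1 with rfl | hα₁
  · have h_log : Real.log |r * x| = Real.log r + Real.log |x| := by
      rw [abs_mul, abs_of_pos hr, Real.log_mul hr.ne' (abs_ne_zero.2 hx)]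
    simp only [stableExponent, stableW, logScale, if_true, h_log, real_sign_mul_of_pos hr, h_rpow,
      Real.rpow_one]
    conv_rhs => enter [2, 2, 2, 1, 2, 2]; rw [← real_sign_mul_abs x]
    push_cast
    ring
  · simp only [stableExponent, stableW, logScale, hα₁, if_false, real_sign_mul_of_pos hr, h_rpow]
    push_cast
    ring

lemma rpow_mul_stableExponent_inv_mul {α : ℝ} (hα : α ≠ 0) {q x : ℝ} (hq : 0 ≤ q)
    (hx : q = 0 → x = 0) (b : ℝ) :
    (q ^ α : ℝ) * stableExponent α b (q⁻¹ * x) =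
      stableExponent α b x - Complex.I * (2 / Real.pi * (b * logScale α q * x) : ℝ) := by
  rcases hq.eq_or_lt with rfl | hq
  · simp [hx rfl, stableExponent_apply_zero hα]
  have h_cancel : (q ^ α : ℝ) * (q⁻¹ ^ α : ℝ) = (1 : ℂ) := by
    rw [← Complex.ofReal_mul, ← Real.mul_rpow hq.le (by positivity), mul_inv_cancel₀ hq.ne',
      Real.one_rpow, Complex.ofReal_one]
  have h_log : logScale α q⁻¹ = -logScale α q := by
    simp only [logScale, Real.log_inv]
    split_ifs <;> simp
  rw [stableExponent_pos_mul hα b (by positivity), ← mul_assoc, h_cancel, h_log]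
  push_cast
  ring

lemma measurable_stableExponent (α b : ℝ) : Measurable (stableExponent α b) := by
  have h_sign : Measurable Real.sign := by
    unfold Real.sign
    exact Measurable.ite measurableSet_Iio measurable_const
      (Measurable.ite measurableSet_Ioi measurable_const measurable_const)
  have h_w : Measurable (stableW α) := by
    unfold stableW
    split_ifs <;> fun_prop
  unfold stableExponent
  fun_prop

lemma abs_rpow_le_norm_stableExponent (α b x : ℝ) : |x| ^ α ≤ ‖stableExponent α b x‖ := by
  rw [← stableExponent_re α b x]
  exact Complex.re_le_norm _

lemma abs_mul_abs_log_le_norm_stableExponent (x : ℝ) :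
    |x| * |Real.log x| ≤ Real.pi / 2 * ‖stableExponent 1 1 x‖ := by
  rcases eq_or_ne x 0 with rfl | hx
  · simp [stableExponent_apply_zero]
  have h_sign : |Real.sign x| = 1 := by
    rcases Real.sign_apply_eq_of_ne_zero x hx with h | h <;> simp [h]
  have h_im : |(stableExponent 1 1 x).im| = 2 / Real.pi * (|x| * |Real.log x|) := by
    rw [← abs_rpow_one_mul_abs_stableW, stableExponent_im, abs_neg, abs_mul, abs_mul, abs_mul,
      abs_one, one_mul, h_sign, one_mul, abs_of_nonneg (by positivity : 0 ≤ |x| ^ (1 : ℝ))]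
  calc |x| * |Real.log x| = Real.pi / 2 * |(stableExponent 1 1 x).im| := by
        rw [h_im]; field_simp
    _ ≤ Real.pi / 2 * ‖stableExponent 1 1 x‖ := by gcongr; exact Complex.abs_im_le_norm _

end StableExponentScaling

section AtomicMeasure

variable {ι E : Type*} [MeasurableSpace E] {w : ι → ℝ} {s : ι → E}

/-- The measure with mass `w i` at the point `s i`; negative weights count as `0`. -/
noncomputable def atomicMeasure (w : ι → ℝ) (s : ι → E) : Measure E :=
  Measure.sum fun i => ENNReal.ofReal (w i) • Measure.dirac (s i)

lemma lintegral_atomicMeasure {f : E → ℝ≥0∞} (hf : Measurable f) :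
    ∫⁻ x, f x ∂atomicMeasure w s = ∑' i, ENNReal.ofReal (w i) * f (s i) := by
  simp only [atomicMeasure, lintegral_sum_measure, lintegral_smul_measure, lintegral_dirac' _ hf,
    smul_eq_mul]

lemma map_atomicMeasure {F : Type*} [MeasurableSpace F] {g : E → F} (hg : Measurable g) :
    (atomicMeasure w s).map g = atomicMeasure w fun i => g (s i) := by
  simp only [atomicMeasure, Measure.map_sum hg.aemeasurable, Measure.map_smul,
    Measure.map_dirac' hg]

lemma atomicMeasure_apply_eq_zero {A : Set E} (hA : MeasurableSet A)
    (h : ∀ i, w i = 0 ∨ s i ∉ A) : atomicMeasure w s A = 0 := by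
  rw [atomicMeasure, Measure.sum_apply _ hA, ENNReal.tsum_eq_zero]
  intro i
  rw [Measure.smul_apply, Measure.dirac_apply' _ hA]
  rcases h i with h | h <;> simp [h]

lemma of_ae_atomicMeasure [Countable ι] [MeasurableSingletonClass E] {P : E → Prop}
    (h : ∀ᵐ x ∂atomicMeasure w s, P x) {i : ι} (hw : 0 < w i) : P (s i) := by
  have h_atom := (Measure.ae_sum_iff.1 h) i
  rwa [Measure.ae_ennreal_smul_measure_iff (by simpa using hw), ae_dirac_eq] at h_atom

variable {F : Type*} [NormedAddCommGroup F] [NormedSpace ℝ F] [FiniteDimensional ℝ F] {f : E → F}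

lemma integrable_atomicMeasure (hw : ∀ i, 0 ≤ w i) (hf : StronglyMeasurable f)
    (h : Summable fun i => w i • f (s i)) : Integrable f (atomicMeasure w s) := by
  refine ⟨hf.aestronglyMeasurable, ?_⟩
  rw [HasFiniteIntegral, lintegral_atomicMeasure hf.enorm]
  convert h.norm.tsum_ofReal_ne_top.lt_top using 4 with i
  rw [norm_smul, Real.norm_of_nonneg (hw i), ENNReal.ofReal_mul (hw i), ofReal_norm]

lemma integral_atomicMeasure (hw : ∀ i, 0 ≤ w i) (hf : StronglyMeasurable f)
    (h : Summable fun i => w i • f (s i)) :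
    ∫ x, f x ∂atomicMeasure w s = ∑' i, w i • f (s i) := by
  have h_int := integrable_atomicMeasure hw hf h
  rw [atomicMeasure] at h_int ⊢
  simp only [integral_sum_measure h_int, integral_smul_measure, integral_dirac' _ _ hf,
    ENNReal.toReal_ofReal (hw _)]

end AtomicMeasure

section CylinderMeasure

variable {ι E : Type*} [NormedAddCommGroup E] [InnerProductSpace ℝ E] {p : Seminorm ℝ E}
  {α β a b : ℝ} {c : ι → E}

lemma hasSum_rpow_mul_stableExponent (hα : α ≠ 0) (hc : ∀ i, p (c i) = 0 → c i = 0) {u v : E}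
    (h_sum : Summable fun i => stableExponent α b ⟪u, c i⟫_ℝ)
    (hv : HasSum (fun i => (b * logScale α (p (c i))) • c i) v) (r : ℝ) :
    HasSum (fun i => (r * p (c i) ^ α) • stableExponent α b ⟪u, (p (c i))⁻¹ • c i⟫_ℝ)
      (r * (∑' i, stableExponent α b ⟪u, c i⟫_ℝ -
        Complex.I * (2 / Real.pi * ⟪u, v⟫_ℝ : ℝ))) := by
  have h_drift : HasSum (fun i => b * logScale α (p (c i)) * ⟪u, c i⟫_ℝ) ⟪u, v⟫_ℝ := by
    simpa only [innerSL_apply_apply, inner_smul_right] using hv.mapL (innerSL ℝ u)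
  refine ((h_sum.hasSum.sub ((Complex.hasSum_ofReal.2
    (h_drift.mul_left (2 / Real.pi))).mul_left Complex.I)).mul_left (r : ℂ)).congr_fun fun i => ?_
  rw [← rpow_mul_stableExponent_inv_mul hα (apply_nonneg p (c i)) (fun h => by simp [hc i h]),
    inner_smul_right, Complex.real_smul, Complex.ofReal_mul, mul_assoc]

variable [MeasurableSpace E]

/-- The spectral measure on the unit cylinder of `p` of a stable series with coefficients `c`: the
term `c i` contributes the mass `a * p (c i) ^ α`, of which the fractions `(1 + β) / 2` and
`(1 - β) / 2` sit in the directions `c i` and `-c i`. -/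
noncomputable def cylinderMeasure (p : Seminorm ℝ E) (α β a : ℝ) (c : ι → E) : Measure E :=
  atomicMeasure (fun i => a * ((1 + β) / 2) * p (c i) ^ α) (fun i => (p (c i))⁻¹ • c i) +
    atomicMeasure (fun i => a * ((1 - β) / 2) * p (c i) ^ α) (fun i => (p (c i))⁻¹ • -c i)

lemma isSymmetricMeasure_cylinderMeasure [MeasurableNeg E] :
    IsSymmetricMeasure (cylinderMeasure p α 0 a c) := by
  rw [IsSymmetricMeasure, cylinderMeasure, Measure.map_add _ _ measurable_neg,
    map_atomicMeasure measurable_neg, map_atomicMeasure measurable_neg, add_comm]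
  simp only [add_zero, sub_zero, smul_neg, neg_neg]

variable [BorelSpace E]

lemma measurable_stableExponent_inner (α b : ℝ) (u : E) :
    Measurable fun s : E => stableExponent α b ⟪u, s⟫_ℝ :=
  (measurable_stableExponent α b).comp (continuous_const.inner continuous_id).measurable

lemma integral_cylinderMeasure_stableExponent (hα : α ≠ 0) (hβ₁ : -1 ≤ β) (hβ₂ : β ≤ 1)
    (ha : 0 ≤ a) (hc : ∀ i, p (c i) = 0 → c i = 0) {v : E}
    (h_sum : ∀ u : E, Summable fun i => stableExponent α b ⟪u, c i⟫_ℝ)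
    (hv : HasSum (fun i => (b * logScale α (p (c i))) • c i) v) (u : E) :
    Integrable (fun s => stableExponent α b ⟪u, s⟫_ℝ) (cylinderMeasure p α β a c) ∧
    ∫ s, stableExponent α b ⟪u, s⟫_ℝ ∂cylinderMeasure p α β a c =
      a * ∑' i, stableExponent α (β * b) ⟪u, c i⟫_ℝ -
        Complex.I * (a * (2 / Real.pi) * β * ⟪u, v⟫_ℝ : ℝ) := by
  have h_sum' : Summable fun i => stableExponent α b ⟪u, -c i⟫_ℝ := by
    simpa only [inner_neg_left, inner_neg_right] using h_sum (-u)
  have hv' : HasSum (fun i => (b * logScale α (p (-c i))) • -c i) (-v) := by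
    simpa only [smul_neg, map_neg_eq_map] using hv.neg
  have h_weight : ∀ {r : ℝ}, 0 ≤ r → ∀ i, 0 ≤ a * (r / 2) * p (c i) ^ α := fun hr i =>
    mul_nonneg (by positivity) (Real.rpow_nonneg (apply_nonneg p _) _)
  have h_weight₁ := h_weight (by linarith : 0 ≤ 1 + β)
  have h_weight₂ := h_weight (by linarith : 0 ≤ 1 - β)
  have hm := (measurable_stableExponent_inner α b u).stronglyMeasurable
  have h₁ := hasSum_rpow_mul_stableExponent hα hc (h_sum u) hv (a * ((1 + β) / 2))
  have h₂ := hasSum_rpow_mul_stableExponent (c := fun i => -c i) hα (by simpa using hc) h_sum' hv'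
    (a * ((1 - β) / 2))
  simp only [map_neg_eq_map] at h₂
  have h_int₁ := integrable_atomicMeasure h_weight₁ hm h₁.summable
  have h_int₂ := integrable_atomicMeasure h_weight₂ hm h₂.summable
  refine ⟨h_int₁.add_measure h_int₂, ?_⟩
  rw [cylinderMeasure, integral_add_measure h_int₁ h_int₂,
    integral_atomicMeasure h_weight₁ hm h₁.summable,
    integral_atomicMeasure h_weight₂ hm h₂.summable, h₁.tsum_eq, h₂.tsum_eq]
  simp only [stableExponent_mul_skewness α β, inner_neg_right] at h_sum' ⊢
  rw [((h_sum u).mul_left _).tsum_add (h_sum'.mul_left _), tsum_mul_left, tsum_mul_left]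
  push_cast
  ring

end CylinderMeasure

section Sufficiency

variable {n : ℕ} {p : Seminorm ℝ (EuclideanSpace ℝ (Fin n))} {ι : Type*}
  {c : ι → EuclideanSpace ℝ (Fin n)} {α β a : ℝ}
  {law : Measure (EuclideanSpace ℝ (Fin n))}

lemma measurableSet_unitCylinder (p : Seminorm ℝ (EuclideanSpace ℝ (Fin n))) :
    MeasurableSet (unitCylinder p) :=
  (isClosed_eq p.convexOn.locallyLipschitz.continuous continuous_const).measurableSet

lemma cylinderMeasure_compl_unitCylinder (hα : α ≠ 0) :
    cylinderMeasure p α β a c (unitCylinder p)ᶜ = 0 := by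
  have h_mem : ∀ i, p (c i) ≠ 0 → p ((p (c i))⁻¹ • c i) = 1 := fun i h => by
    rw [map_smul_eq_mul, norm_inv, Real.norm_of_nonneg (apply_nonneg p _), inv_mul_cancel₀ h]
  rw [cylinderMeasure, Measure.add_apply, add_eq_zero]
  constructor
  all_goals
    refine atomicMeasure_apply_eq_zero (measurableSet_unitCylinder p).compl fun i => ?_
    rcases eq_or_ne (p (c i)) 0 with h | h
    · simp [h, Real.zero_rpow hα]
    · simp [unitCylinder, h_mem i h]

lemma lintegral_ofReal_lt_top_of_le_norm {E : Type*} [MeasurableSpace E] {Γ : Measure E}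
    {f : E → ℂ} (hf : Integrable f Γ) {g : E → ℝ} {C : ℝ} (h : ∀ s, g s ≤ C * ‖f s‖) :
    ∫⁻ s, ENNReal.ofReal (g s) ∂Γ < ∞ :=
  (lintegral_mono fun s => ENNReal.ofReal_le_ofReal (h s)).trans_lt
    (hf.norm.const_mul C).lintegral_lt_top

theorem IsStableSeriesLaw.isRepresentableAsymm (h : IsStableSeriesLaw α β a c law) (hα : 0 < α)
    (hβ₁ : -1 ≤ β) (hβ₂ : β ≤ 1) (ha : 0 ≤ a) (h_skew : α = 1 → β ≠ 0)
    (hc : ∀ i, p (c i) = 0 → c i = 0) (h_log : Summable fun i => ‖c i‖ * |logScale α (p (c i))|) :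
    IsRepresentableAsymm α p law := by
  have h_sum : ∀ u, Summable fun i => stableExponent α 1 ⟪u, c i⟫_ℝ := fun u =>
    summable_stableExponent (summable_abs_inner_rpow hα.le h.summable_rpow u)
      fun hα₁ _ => h.summable_inner_log hα₁ (h_skew hα₁) u
  have h_drift : Summable fun i => (1 * logScale α (p (c i))) • c i :=
    Summable.of_norm (by simpa only [one_mul, norm_smul, Real.norm_eq_abs, mul_comm] using h_log)
  have h_int := integral_cylinderMeasure_stableExponent hα.ne' hβ₁ hβ₂ ha hc h_sum h_drift.hasSum
  refine ⟨cylinderMeasure p α β a c,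
    -(a * (2 / Real.pi) * β) • ∑' i, (1 * logScale α (p (c i))) • c i,
    cylinderMeasure_compl_unitCylinder hα.ne', fun _ u => ?_, ?_, fun u => ?_⟩
  · exact lintegral_ofReal_lt_top_of_le_norm (h_int u).1 (C := 1) fun s => by
      simpa using abs_rpow_le_norm_stableExponent α 1 _
  · rintro rfl u
    simpa only [Real.log_abs] using lintegral_ofReal_lt_top_of_le_norm (h_int u).1
      fun s => abs_mul_abs_log_le_norm_stableExponent _
  · rw [h.charFun_eq, (h_int u).2, tsum_mul_left, mul_one, inner_smul_right]
    push_cast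
    ring_nf

theorem IsStableSeriesLaw.isRepresentableSymm (h : IsStableSeriesLaw α 0 a c law) (hα : 0 < α)
    (ha : 0 ≤ a) (hc : ∀ i, p (c i) = 0 → c i = 0) : IsRepresentableSymm α p law := by
  have h_drift : HasSum (fun i => ((0 : ℝ) * logScale α (p (c i))) • c i) 0 := by
    simpa only [zero_mul, zero_smul] using hasSum_zero
  have h_int := integral_cylinderMeasure_stableExponent hα.ne' (by norm_num : (-1 : ℝ) ≤ 0)
    zero_le_one ha hc (fun u => h.summable_stableExponent_inner hα.le u) h_drift
  refine ⟨cylinderMeasure p α 0 a c, cylinderMeasure_compl_unitCylinder hα.ne',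
    isSymmetricMeasure_cylinderMeasure, fun u => ?_, fun u => ?_⟩
  · exact lintegral_ofReal_lt_top_of_le_norm (h_int u).1 (C := 1) fun s => by
      simpa using abs_rpow_le_norm_stableExponent α 0 _
  · have h_eq := (h_int u).2
    simp only [stableExponent_zero_skewness α ⟪u, _⟫_ℝ, integral_complex_ofReal, inner_zero_right,
      mul_zero, Complex.ofReal_zero, sub_zero] at h_eq
    rw [h.charFun_eq, tsum_mul_left, h_eq]
    simp only [stableExponent_zero_skewness]

end Sufficiency

/-! ### Symmetric laws -/

section SymmetricLaw

lemma tendsto_rpow_mul_logScale_nhdsGT_zero {α : ℝ} (hα : 0 < α) :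
    Filter.Tendsto (fun t => t ^ α * logScale α t) (𝓝[>] 0) (𝓝 0) := by
  unfold logScale
  split_ifs
  · simpa only [mul_comm] using tendsto_log_mul_rpow_nhdsGT_zero hα
  · simpa only [mul_zero] using tendsto_const_nhds

-- Near `0` the sine vanishes only if its argument does; comparing the arguments at `t` and `t ^ 2`
-- then eliminates `B`.
lemma eq_zero_of_sin_rpow_mul_eq_zero {α A B : ℝ} (hα : 0 < α)
    (h : ∀ t, 0 < t → Real.sin (t ^ α * (A + logScale α t * B)) = 0) : A = 0 := by
  have h_rpow : Filter.Tendsto (fun t : ℝ => t ^ α) (𝓝[>] 0) (𝓝 0) := by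
    simpa only [Real.zero_rpow hα.ne'] using
      ((Real.continuous_rpow_const hα.le).tendsto 0).mono_left nhdsWithin_le_nhds
  have h_lim : Filter.Tendsto (fun t : ℝ => t ^ α * (A + logScale α t * B)) (𝓝[>] 0) (𝓝 0) := by
    simpa only [mul_add, ← mul_assoc, zero_mul, add_zero] using
      (h_rpow.mul_const A).add ((tendsto_rpow_mul_logScale_nhdsGT_zero hα).mul_const B)
  have h_zero : ∀ᶠ t in 𝓝[>] (0 : ℝ), A + logScale α t * B = 0 := by
    filter_upwards [h_lim (Ioo_mem_nhds (neg_lt_zero.2 Real.pi_pos) Real.pi_pos),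
      self_mem_nhdsWithin] with t ht ht₀
    exact (mul_eq_zero.1 ((Real.sin_eq_zero_iff_of_lt_of_lt ht.1 ht.2).1 (h t ht₀))).resolve_left
      (Real.rpow_pos_of_pos ht₀ α).ne'
  have h_sq : Filter.Tendsto (fun t : ℝ => t ^ 2) (𝓝[>] 0) (𝓝[>] 0) := by
    refine tendsto_nhdsWithin_iff.2 ⟨?_, ?_⟩
    · simpa using ((continuous_pow 2).tendsto (0 : ℝ)).mono_left nhdsWithin_le_nhds
    · filter_upwards [self_mem_nhdsWithin] with t ht using pow_pos (Set.mem_Ioi.1 ht) 2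
  obtain ⟨t, ht, ht_sq⟩ := (h_zero.and (h_sq.eventually h_zero)).exists
  have h_log : logScale α (t ^ 2) = 2 * logScale α t := by
    simp only [logScale, Real.log_pow]
    split_ifs <;> simp
  rw [h_log] at ht_sq
  linarith

lemma tsum_stableExponent_pos_mul {ι : Type*} {α b : ℝ} {x : ι → ℝ} (hα : α ≠ 0)
    (hx : Summable fun i => |x i| ^ α) (h_sum : Summable fun i => stableExponent α b (x i))
    {t : ℝ} (ht : 0 < t) :
    ∑' i, stableExponent α b (t * x i) = (t ^ α : ℝ) * (∑' i, stableExponent α b (x i) +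
      Complex.I * (2 / Real.pi * (b * logScale α t * ∑' i, x i) : ℝ)) := by
  have h_drift : HasSum (fun i => b * logScale α t * x i) (b * logScale α t * ∑' i, x i) := by
    rcases eq_or_ne α 1 with rfl | hα₁
    · have h_abs : Summable x := Summable.of_abs (by simpa only [Real.rpow_one] using hx)
      exact h_abs.hasSum.mul_left _
    · simpa only [logScale, hα₁, if_false, mul_zero, zero_mul] using hasSum_zero
  simp only [stableExponent_pos_mul hα b ht]
  exact ((h_sum.hasSum.add ((Complex.hasSum_ofReal.2
    (h_drift.mul_left (2 / Real.pi))).mul_left Complex.I)).mul_left ((t ^ α : ℝ) : ℂ)).tsum_eq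

variable {ι E : Type*} [NormedAddCommGroup E] [InnerProductSpace ℝ E] [MeasurableSpace E]
  {law : Measure E} {α β a : ℝ} {c : ι → E}

lemma IsStableSeriesLaw.isProbabilityMeasure (h : IsStableSeriesLaw α β a c law) (hα : α ≠ 0) :
    IsProbabilityMeasure law := by
  have h_univ := h.charFun_eq 0
  simp only [charFun_zero, inner_zero_left, stableExponent_apply_zero hα, mul_zero, tsum_zero,
    neg_zero, Complex.exp_zero, Complex.ofReal_eq_one] at h_univ
  exact isProbabilityMeasure_iff_real.2 h_univ

variable [BorelSpace E]

lemma charFun_neg_of_isSymmetricMeasure (h : IsSymmetricMeasure law) (u : E) :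
    charFun law (-u) = charFun law u := by
  conv_rhs => rw [← h]
  simpa using (charFun_map_smul (μ := law) (-1) u).symm

lemma isSymmetricMeasure_of_charFun_neg [CompleteSpace E] [SecondCountableTopology E]
    [IsFiniteMeasure law] (h : ∀ u, charFun law (-u) = charFun law u) :
    IsSymmetricMeasure law := by
  refine Measure.ext_of_charFun (funext fun u => ?_)
  simpa [h] using charFun_map_smul (μ := law) (-1) u

lemma charFun_im_eq_zero_of_isSymmetricMeasure (h : IsSymmetricMeasure law) (u : E) :
    (charFun law u).im = 0 :=
  Complex.conj_eq_iff_im.1 (by rw [← charFun_neg, charFun_neg_of_isSymmetricMeasure h])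

lemma IsStableSeriesLaw.isSymmetricMeasure [CompleteSpace E] [SecondCountableTopology E]
    (h : IsStableSeriesLaw α 0 a c law) (hα : α ≠ 0) : IsSymmetricMeasure law :=
  have := h.isProbabilityMeasure hα
  isSymmetricMeasure_of_charFun_neg fun u => by
    simp only [h.charFun_eq, inner_neg_left, stableExponent_zero_skewness, abs_neg]

lemma IsStableSeriesLaw.im_tsum_eq_zero_of_isSymmetricMeasure (h : IsStableSeriesLaw α β a c law)
    (hα : 0 < α) (h_symm : IsSymmetricMeasure law) (u : E) :
    (∑' i, a * stableExponent α β ⟪u, c i⟫_ℝ).im = 0 := by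
  have h_sin : ∀ t : ℝ, Real.sin (a * (∑' i, stableExponent α β (t * ⟪u, c i⟫_ℝ)).im) = 0 := by
    intro t
    have h_im := charFun_im_eq_zero_of_isSymmetricMeasure h_symm (t • u)
    rw [h.charFun_eq, Complex.exp_im, mul_eq_zero, Complex.neg_im, Real.sin_neg, neg_eq_zero,
      tsum_mul_left, Complex.im_ofReal_mul] at h_im
    simpa only [inner_smul_left, conj_trivial] using h_im.resolve_left (Real.exp_pos _).ne'
  rw [tsum_mul_left, Complex.im_ofReal_mul]
  refine eq_zero_of_sin_rpow_mul_eq_zero (B := a * (2 / Real.pi * (β * ∑' i, ⟪u, c i⟫_ℝ))) hα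
    fun t ht => ?_
  have h_scale := h_sin t
  rw [tsum_stableExponent_pos_mul hα.ne' (summable_abs_inner_rpow hα.le h.summable_rpow u)
    (h.summable_stableExponent_inner hα.le u) ht, Complex.im_ofReal_mul, Complex.add_im,
    Complex.I_mul_im, Complex.ofReal_re] at h_scale
  rw [← h_scale]
  ring_nf

lemma IsStableSeriesLaw.zero_skewness (h : IsStableSeriesLaw α β a c law) (hα : 0 < α)
    (h_symm : IsSymmetricMeasure law) : IsStableSeriesLaw α 0 a c law := by
  refine ⟨h.summable_rpow, fun _ h₀ => absurd rfl h₀, fun u => ?_⟩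
  have h_sum := (h.summable_stableExponent_inner hα.le u).mul_left (a : ℂ)
  rw [h.charFun_eq, ← Complex.re_add_im (∑' i, a * stableExponent α β ⟪u, c i⟫_ℝ),
    h.im_tsum_eq_zero_of_isSymmetricMeasure hα h_symm, Complex.re_tsum h_sum, Complex.ofReal_tsum]
  simp [stableExponent_re, stableExponent_zero_skewness]

end SymmetricLaw

/-! ### Absolute moments of the spectral measure -/

section AbsMoments

variable {ι E : Type*} [NormedAddCommGroup E] [InnerProductSpace ℝ E] [MeasurableSpace E]
  {α β a : ℝ} {c : ι → E} {law Γ N : Measure E}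

/-- All linear functionals have the same finite absolute moment of order `α` under `Γ` and `N`.
This is all that the modulus of the characteristic function retains of a spectral measure. -/
structure HaveSameAbsMoments (α : ℝ) (Γ N : Measure E) : Prop where
  integrable_left : ∀ u, Integrable (fun s => |⟪u, s⟫_ℝ| ^ α) Γ
  integrable_right : ∀ u, Integrable (fun s => |⟪u, s⟫_ℝ| ^ α) N
  integral_eq : ∀ u, ∫ s, |⟪u, s⟫_ℝ| ^ α ∂Γ = ∫ s, |⟪u, s⟫_ℝ| ^ α ∂N

lemma IsStableSeriesLaw.norm_charFun (h : IsStableSeriesLaw α β a c law) (hα : 0 ≤ α) (u : E) :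
    ‖charFun law u‖ = Real.exp (-∑' i, a * |⟪u, c i⟫_ℝ| ^ α) := by
  rw [h.charFun_eq, Complex.norm_exp, Complex.neg_re,
    Complex.re_tsum ((h.summable_stableExponent_inner hα u).mul_left _)]
  simp only [Complex.re_ofReal_mul, stableExponent_re]

lemma IsStableSeriesLaw.haveSameAbsMoments [BorelSpace E] (h : IsStableSeriesLaw α β a c law)
    (hα : 0 ≤ α) (ha : 0 ≤ a) (h_int : ∀ u, Integrable (fun s => |⟪u, s⟫_ℝ| ^ α) Γ)
    (h_norm : ∀ u, ‖charFun law u‖ = Real.exp (-∫ s, |⟪u, s⟫_ℝ| ^ α ∂Γ)) :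
    HaveSameAbsMoments α Γ (atomicMeasure (fun _ => a) c) := by
  have hm : ∀ u : E, StronglyMeasurable fun s => |⟪u, s⟫_ℝ| ^ α := fun u =>
    ((continuous_const.inner continuous_id).measurable.abs.pow_const α).stronglyMeasurable
  have h_sum : ∀ u, Summable fun i => a • |⟪u, c i⟫_ℝ| ^ α := fun u =>
    (summable_abs_inner_rpow hα h.summable_rpow u).const_smul a
  refine ⟨h_int, fun u => integrable_atomicMeasure (fun _ => ha) (hm u) (h_sum u), fun u => ?_⟩
  have h_exp := (h_norm u).symm.trans (h.norm_charFun hα u)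
  rw [integral_atomicMeasure (fun _ => ha) (hm u) (h_sum u)]
  simpa only [smul_eq_mul, Real.exp_eq_exp, neg_inj] using h_exp

end AbsMoments

section Representable

-- The two logarithms differ by `log 2`, so they are not both small.
lemma abs_le_two_mul_abs_mul_abs_log (x : ℝ) :
    |x| ≤ 2 * (|x| * |Real.log x| + |2 * x| * |Real.log (2 * x)|) := by
  rcases eq_or_ne x 0 with rfl | hx
  · simp
  have h_log : 1 / 2 ≤ |Real.log x| + |Real.log (2 * x)| := by
    have h_two := Real.log_two_gt_d9
    rw [Real.log_mul two_ne_zero hx]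
    linarith [le_abs_self (Real.log 2 + Real.log x), neg_le_abs (Real.log x)]
  rw [abs_mul, abs_two]
  nlinarith [abs_nonneg x, mul_nonneg (abs_nonneg x) (abs_nonneg (Real.log (2 * x)))]

section InnerProductSpace

variable {E : Type*} [NormedAddCommGroup E] [InnerProductSpace ℝ E] [MeasurableSpace E]
  {Γ : Measure E} {α b : ℝ}

lemma norm_exp_neg_integral_stableExponent {u : E}
    (h : Integrable (fun s => stableExponent α b ⟪u, s⟫_ℝ) Γ) (r : ℝ) :
    ‖Complex.exp (-(∫ s, stableExponent α b ⟪u, s⟫_ℝ ∂Γ) + Complex.I * r)‖ =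
      Real.exp (-∫ s, |⟪u, s⟫_ℝ| ^ α ∂Γ) := by
  have h_re : (∫ s, stableExponent α b ⟪u, s⟫_ℝ ∂Γ).re = ∫ s, |⟪u, s⟫_ℝ| ^ α ∂Γ := by
    rw [← Complex.reCLM_apply, ← Complex.reCLM.integral_comp_comm h]
    simp only [Complex.reCLM_apply, stableExponent_re]
  simp [Complex.norm_exp, h_re]

variable [BorelSpace E]

lemma integrable_abs_inner_of_integrable_mul_log
    (h : ∀ u : E, Integrable (fun s => |⟪u, s⟫_ℝ| * |Real.log ⟪u, s⟫_ℝ|) Γ) (u : E) :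
    Integrable (fun s => |⟪u, s⟫_ℝ|) Γ := by
  refine Integrable.mono' (((h u).add (h ((2 : ℝ) • u))).const_mul 2)
    (continuous_const.inner continuous_id).abs.measurable.aestronglyMeasurable
    (ae_of_all _ fun s => ?_)
  simpa only [Real.norm_eq_abs, abs_abs, Pi.add_apply, inner_smul_left, RCLike.conj_to_real]
    using abs_le_two_mul_abs_mul_abs_log ⟪u, s⟫_ℝ

lemma integrable_stableExponent_inner {u : E} (h : Integrable (fun s => |⟪u, s⟫_ℝ| ^ α) Γ)
    (h_log : α = 1 → Integrable (fun s => |⟪u, s⟫_ℝ| * |Real.log ⟪u, s⟫_ℝ|) Γ) :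
    Integrable (fun s => stableExponent α b ⟪u, s⟫_ℝ) Γ := by
  have h_weighted : Integrable (fun s => |⟪u, s⟫_ℝ| ^ α * |stableW α ⟪u, s⟫_ℝ|) Γ := by
    by_cases hα : α = 1
    · subst hα
      simpa only [abs_rpow_one_mul_abs_stableW] using (h_log rfl).const_mul (2 / Real.pi)
    · simpa only [stableW, hα, if_false] using h.mul_const |Real.tan (Real.pi * α / 2)|
  exact Integrable.mono' (h.add (h_weighted.const_mul |b|))
    (measurable_stableExponent_inner α b u).aestronglyMeasurable
    (ae_of_all _ fun s => norm_stableExponent_le α b _)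

end InnerProductSpace

variable {ι : Type*} {n : ℕ} {p : Seminorm ℝ (EuclideanSpace ℝ (Fin n))}
  {c : ι → EuclideanSpace ℝ (Fin n)} {α β a : ℝ} {law : Measure (EuclideanSpace ℝ (Fin n))}

lemma IsRepresentableAsymm.exists_haveSameAbsMoments (h_rep : IsRepresentableAsymm α p law)
    (h : IsStableSeriesLaw α β a c law) (hα : 0 ≤ α) (ha : 0 ≤ a) :
    ∃ Γ, Γ (unitCylinder p)ᶜ = 0 ∧ HaveSameAbsMoments α Γ (atomicMeasure (fun _ => a) c) ∧
      (α = 1 → ∀ u, Integrable (fun s => |⟪u, s⟫_ℝ| * |Real.log ⟪u, s⟫_ℝ|) Γ) := by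
  obtain ⟨Γ, μ₀, h_supp, h_rpow, h_log, h_law⟩ := h_rep
  have h_log' : α = 1 → ∀ u, Integrable (fun s => |⟪u, s⟫_ℝ| * |Real.log ⟪u, s⟫_ℝ|) Γ :=
    fun hα₁ u => by
      refine (lintegral_ofReal_ne_top_iff_integrable (Measurable.aestronglyMeasurable (by fun_prop))
        (ae_of_all _ fun s => by positivity)).1 ?_
      simpa only [Real.log_abs] using (h_log hα₁ u).ne
  have h_int : ∀ u, Integrable (fun s => |⟪u, s⟫_ℝ| ^ α) Γ := fun u => by
    by_cases hα₁ : α = 1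
    · subst hα₁
      simpa only [Real.rpow_one] using integrable_abs_inner_of_integrable_mul_log (h_log' rfl) u
    · exact (lintegral_ofReal_ne_top_iff_integrable (Measurable.aestronglyMeasurable (by fun_prop))
        (ae_of_all _ fun s => by positivity)).1 (h_rpow hα₁ u).ne
  refine ⟨Γ, h_supp, h.haveSameAbsMoments hα ha h_int fun u => ?_, h_log'⟩
  rw [h_law, norm_exp_neg_integral_stableExponent
    (integrable_stableExponent_inner (h_int u) fun hα₁ => h_log' hα₁ u)]

lemma IsRepresentableSymm.exists_haveSameAbsMoments (h_rep : IsRepresentableSymm α p law)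
    (h : IsStableSeriesLaw α β a c law) (hα : 0 ≤ α) (ha : 0 ≤ a) :
    ∃ Γ, Γ (unitCylinder p)ᶜ = 0 ∧ HaveSameAbsMoments α Γ (atomicMeasure (fun _ => a) c) := by
  obtain ⟨Γ, h_supp, -, h_rpow, h_law⟩ := h_rep
  refine ⟨Γ, h_supp, h.haveSameAbsMoments hα ha (fun u => ?_) fun u => ?_⟩
  · exact (lintegral_ofReal_ne_top_iff_integrable (Measurable.aestronglyMeasurable (by fun_prop))
      (ae_of_all _ fun s => by positivity)).1 (h_rpow u).ne
  · rw [h_law, Complex.norm_exp, ← Complex.ofReal_neg, Complex.ofReal_re]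

end Representable

/-! ### Spectral measures and the kernel of a linear map -/

section GaussianSlab

lemma gaussianPDFReal_le (μ : ℝ) (v : NNReal) (x : ℝ) :
    gaussianPDFReal μ v x ≤ (√(2 * Real.pi * v))⁻¹ := by
  refine mul_le_of_le_one_right (by positivity) (Real.exp_le_one_iff.2 ?_)
  exact div_nonpos_of_nonpos_of_nonneg (neg_nonpos.2 (sq_nonneg _)) (by positivity)

lemma gaussianReal_Ioo_le (μ : ℝ) {v : NNReal} (hv : v ≠ 0) (x y : ℝ) :
    gaussianReal μ v (Set.Ioo x y) ≤ ENNReal.ofReal ((√(2 * Real.pi * v))⁻¹ * (y - x)) := by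
  rw [gaussianReal_apply _ hv, ENNReal.ofReal_mul (by positivity), ← Real.volume_Ioo,
    ← setLIntegral_const]
  exact lintegral_mono fun z => ENNReal.ofReal_le_ofReal (gaussianPDFReal_le μ v z)

variable {E : Type*} [NormedAddCommGroup E] [InnerProductSpace ℝ E] [FiniteDimensional ℝ E]
  [MeasurableSpace E] [BorelSpace E]

lemma map_inner_stdGaussian (y : E) :
    (stdGaussian E).map (fun v => ⟪v, y⟫_ℝ) = gaussianReal 0 (‖y‖₊ ^ 2) := by
  have h := IsGaussian.map_eq_gaussianReal (μ := stdGaussian E) (innerSL ℝ y)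
  rw [integral_strongDual_stdGaussian, variance_dual_stdGaussian, innerSL_apply_norm] at h
  simp only [real_inner_comm, ← innerSL_apply_apply ℝ y]
  rw [h, ← coe_nnnorm, ← NNReal.coe_pow, Real.toNNReal_coe]

lemma stdGaussian_abs_inner_lt_le {y : E} (hy : y ≠ 0) {δ : ℝ} (hδ : 0 ≤ δ) :
    stdGaussian E {v | |⟪v, y⟫_ℝ| < δ} ≤ ENNReal.ofReal (δ / ‖y‖) := by
  have h_preimage : {v : E | |⟪v, y⟫_ℝ| < δ} = (fun v => ⟪v, y⟫_ℝ) ⁻¹' Set.Ioo (-δ) δ := by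
    ext v
    exact abs_lt (a := ⟪v, y⟫_ℝ)
  rw [h_preimage, ← Measure.map_apply (by fun_prop) measurableSet_Ioo, map_inner_stdGaussian]
  refine (gaussianReal_Ioo_le 0 (by simpa using hy) _ _).trans (ENNReal.ofReal_le_ofReal ?_)
  have h_sqrt : 2 * ‖y‖ ≤ √(2 * Real.pi * (‖y‖₊ ^ 2 : NNReal)) := by
    refine Real.le_sqrt_of_sq_le ?_
    push_cast
    nlinarith [sq_nonneg ‖y‖, Real.two_le_pi]
  calc (√(2 * Real.pi * (‖y‖₊ ^ 2 : NNReal)))⁻¹ * (δ - -δ)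
      ≤ (2 * ‖y‖)⁻¹ * (δ - -δ) := by
        have : 0 < ‖y‖ := norm_pos_iff.2 hy
        gcongr
        linarith
    _ = δ / ‖y‖ := by field_simp; ring

lemma stdGaussian_inner_eq_zero {y : E} (hy : y ≠ 0) : stdGaussian E {v | ⟪v, y⟫_ℝ = 0} = 0 := by
  have := nullSingletonClass_gaussianReal (μ := 0) (v := ‖y‖₊ ^ 2) (by simpa using hy)
  rw [← measure_singleton (μ := gaussianReal 0 (‖y‖₊ ^ 2)) 0, ← map_inner_stdGaussian,
    Measure.map_apply (by fun_prop) (measurableSet_singleton 0)]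
  rfl

end GaussianSlab

section SecondDifference

variable {α : ℝ}

/-- The symmetric second difference of `|·| ^ α` at `x` with step `y`. -/
noncomputable def secondDiff (α x y : ℝ) : ℝ := |x + y| ^ α + |x - y| ^ α - 2 * |x| ^ α

lemma secondDiff_zero_left (hα : α ≠ 0) (y : ℝ) : secondDiff α 0 y = 2 * |y| ^ α := by
  simp [secondDiff, Real.zero_rpow hα, two_mul]

lemma secondDiff_one (x y : ℝ) : secondDiff 1 x y = 2 * max (|y| - |x|) 0 := by
  simp only [secondDiff, Real.rpow_one]
  rcases abs_cases (x + y) with h₁ | h₁ <;> rcases abs_cases (x - y) with h₂ | h₂ <;>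
    rcases abs_cases y with h₃ | h₃ <;> rcases abs_cases x with h₄ | h₄ <;>
    rcases max_cases (|y| - |x|) 0 with h₅ | h₅ <;> linarith

lemma secondDiff_eq_mul {x : ℝ} (hx : x ≠ 0) (y : ℝ) :
    secondDiff α x y = |x| ^ α * secondDiff α 1 (y / x) := by
  have h_mul : ∀ z, |x * z| ^ α = |x| ^ α * |z| ^ α := fun z => by
    rw [abs_mul, Real.mul_rpow (abs_nonneg _) (abs_nonneg _)]
  have h_add : x + y = x * (1 + y / x) := by field_simp
  have h_sub : x - y = x * (1 - y / x) := by field_simp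
  rw [secondDiff, secondDiff, h_add, h_sub, h_mul, h_mul, abs_one, Real.one_rpow]
  ring

lemma one_sub_abs_one_sub_le_rpow (hα₀ : 0 ≤ α) (hα₁ : α ≤ 1) {z : ℝ} (hz : 0 ≤ z) :
    1 - |1 - z| ≤ z ^ α := by
  rcases le_or_gt z 1 with h | h
  · have h_rpow := Real.rpow_le_rpow_of_exponent_ge_of_imp hz h hα₁
      fun _ h_one => absurd h_one one_ne_zero
    rw [Real.rpow_one] at h_rpow
    linarith [le_abs_self (1 - z), abs_of_nonneg (sub_nonneg.2 h)]
  · linarith [Real.one_le_rpow h.le hα₀, abs_nonneg (1 - z)]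

lemma abs_secondDiff_one_le_of_le_one (hα₀ : 0 ≤ α) (hα₁ : α ≤ 1) {y : ℝ} (hy : |y| ≤ 1) :
    |secondDiff α 1 y| ≤ 2 * |y| := by
  obtain ⟨hy₁, hy₂⟩ := abs_le.1 hy
  have h_lower₁ := one_sub_abs_one_sub_le_rpow hα₀ hα₁ (by linarith : 0 ≤ 1 + y)
  have h_lower₂ := one_sub_abs_one_sub_le_rpow hα₀ hα₁ (by linarith : 0 ≤ 1 - y)
  have h_upper₁ := rpow_one_add_le_one_add_mul_self (s := y) hy₁ hα₀ hα₁
  have h_upper₂ := rpow_one_add_le_one_add_mul_self (s := -y) (by linarith) hα₀ hα₁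
  rw [← sub_eq_add_neg] at h_upper₂
  simp only [sub_add_cancel_left, sub_sub_cancel, abs_neg] at h_lower₁ h_lower₂
  rw [secondDiff, abs_of_nonneg (by linarith : 0 ≤ 1 + y), abs_of_nonneg (by linarith : 0 ≤ 1 - y),
    abs_one, Real.one_rpow, abs_le]
  constructor <;> linarith [abs_nonneg y]

lemma one_add_rpow_le (hα₁ : 1 ≤ α) (hα₂ : α ≤ 2) {y : ℝ} (hy : -1 ≤ y) :
    (1 + y) ^ α ≤ 1 + α * y + (α - 1) * y ^ 2 := by
  rcases hy.eq_or_lt with rfl | hy'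
  · rw [add_neg_cancel, Real.zero_rpow (by linarith)]
    linarith
  · have h_bernoulli := rpow_one_add_le_one_add_mul_self (s := y) hy (p := α - 1) (by linarith)
      (by linarith)
    calc (1 + y) ^ α = (1 + y) * (1 + y) ^ (α - 1) := by
          rw [Real.rpow_sub_one (by linarith), mul_div_cancel₀ _ (by linarith)]
      _ ≤ (1 + y) * (1 + (α - 1) * y) := mul_le_mul_of_nonneg_left h_bernoulli (by linarith)
      _ = 1 + α * y + (α - 1) * y ^ 2 := by ring

lemma abs_secondDiff_one_le_of_one_le (hα₁ : 1 ≤ α) (hα₂ : α ≤ 2) {y : ℝ} (hy : |y| ≤ 1) :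
    |secondDiff α 1 y| ≤ 2 * |y| ^ 2 := by
  obtain ⟨hy₁, hy₂⟩ := abs_le.1 hy
  have h_upper₁ := one_add_rpow_le hα₁ hα₂ hy₁
  have h_upper₂ := one_add_rpow_le hα₁ hα₂ (by linarith : -1 ≤ -y)
  have h_lower₁ := one_add_mul_self_le_rpow_one_add (s := y) hy₁ hα₁
  have h_lower₂ := one_add_mul_self_le_rpow_one_add (s := -y) (by linarith) hα₁
  rw [← sub_eq_add_neg] at h_upper₂ h_lower₂
  rw [secondDiff, abs_of_nonneg (by linarith : 0 ≤ 1 + y), abs_of_nonneg (by linarith : 0 ≤ 1 - y),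
    abs_one, Real.one_rpow, sq_abs, abs_le]
  constructor <;> nlinarith [sq_nonneg y]

lemma exists_abs_secondDiff_one_le (hα₀ : 0 ≤ α) (hα₂ : α < 2) :
    ∃ q, α < q ∧ ∀ y, |y| ≤ 1 → |secondDiff α 1 y| ≤ 2 * |y| ^ q := by
  rcases lt_or_ge α 1 with hα | hα
  · exact ⟨1, hα, fun y hy => by
      simpa only [Real.rpow_one] using abs_secondDiff_one_le_of_le_one hα₀ hα.le hy⟩
  · exact ⟨2, hα₂, fun y hy => by
      simpa only [Real.rpow_two] using abs_secondDiff_one_le_of_one_le hα hα₂.le hy⟩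

lemma abs_secondDiff_le_of_abs_le (hα₀ : 0 < α) (hα₂ : α < 2) {x y : ℝ} (h : |y| ≤ |x|) :
    |secondDiff α x y| ≤ 2 * |y| ^ α := by
  rcases eq_or_ne x 0 with rfl | hx
  · obtain rfl : y = 0 := by simpa using h
    simp [secondDiff, Real.zero_rpow hα₀.ne']
  obtain ⟨q, hq, h_bound⟩ := exists_abs_secondDiff_one_le hα₀.le hα₂
  have h_ratio : |y / x| ≤ 1 := by rwa [abs_div, div_le_one (abs_pos.2 hx)]
  have h_rpow : |y / x| ^ q ≤ |y / x| ^ α :=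
    Real.rpow_le_rpow_of_exponent_ge_of_imp (abs_nonneg _) h_ratio hq.le
      fun _ h_zero => absurd h_zero (hα₀.trans hq).ne'
  calc |secondDiff α x y| = |x| ^ α * |secondDiff α 1 (y / x)| := by
        rw [secondDiff_eq_mul hx, abs_mul, abs_of_nonneg (by positivity : 0 ≤ |x| ^ α)]
    _ ≤ |x| ^ α * (2 * |y / x| ^ α) := by
        gcongr
        exact (h_bound _ h_ratio).trans (by gcongr)
    _ = 2 * |y| ^ α := by
        rw [mul_left_comm, ← Real.mul_rpow (abs_nonneg _) (abs_nonneg _), ← abs_mul,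
          mul_div_cancel₀ _ hx]

lemma abs_secondDiff_le (hα₀ : 0 < α) (hα₂ : α < 2) (x y : ℝ) :
    |secondDiff α x y| ≤ 8 * |y| ^ α := by
  have hy : 0 ≤ |y| ^ α := by positivity
  rcases le_or_gt |y| |x| with h | h
  · linarith [abs_secondDiff_le_of_abs_le hα₀ hα₂ h]
  have h_four : (2 : ℝ) ^ α ≤ 4 :=
    (Real.rpow_le_rpow_of_exponent_le one_le_two hα₂.le).trans_eq (by norm_num)
  have h_double : ∀ z, |z| ≤ 2 * |y| → |z| ^ α ≤ 4 * |y| ^ α := fun z hz =>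
    calc |z| ^ α ≤ (2 * |y|) ^ α := Real.rpow_le_rpow (abs_nonneg _) hz hα₀.le
      _ = 2 ^ α * |y| ^ α := Real.mul_rpow zero_le_two (abs_nonneg _)
      _ ≤ 4 * |y| ^ α := by gcongr
  have hx : |x| ^ α ≤ |y| ^ α := Real.rpow_le_rpow (abs_nonneg _) h.le hα₀.le
  have h_add := h_double (x + y) (by linarith [abs_add_le x y])
  have h_sub := h_double (x - y) (by linarith [abs_sub x y])
  have h_nonneg : ∀ z : ℝ, 0 ≤ |z| ^ α := fun z => by positivity
  rw [secondDiff, abs_le]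
  constructor <;> linarith [h_nonneg x, h_nonneg (x + y), h_nonneg (x - y)]

lemma tendsto_secondDiff_atTop (hα₀ : 0 ≤ α) (hα₂ : α < 2) {x : ℝ} (hx : x ≠ 0) (y : ℝ) :
    Filter.Tendsto (fun R : ℕ => secondDiff α (R * x) y) Filter.atTop (𝓝 0) := by
  obtain ⟨q, hq, h_bound⟩ := exists_abs_secondDiff_one_le hα₀ hα₂
  have h_atTop : Filter.Tendsto (fun R : ℕ => |R * x|) Filter.atTop Filter.atTop := by
    simpa only [abs_mul, Nat.abs_cast] using
      tendsto_natCast_atTop_atTop.atTop_mul_const (abs_pos.2 hx)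
  have h_zero : Filter.Tendsto (fun R : ℕ => 2 * |y| ^ q * |R * x| ^ (-(q - α)))
      Filter.atTop (𝓝 0) := by
    simpa using ((tendsto_rpow_neg_atTop (sub_pos.2 hq)).comp h_atTop).const_mul (2 * |y| ^ q)
  refine squeeze_zero_norm' ?_ h_zero
  filter_upwards [h_atTop.eventually_ge_atTop |y|, h_atTop.eventually_gt_atTop 0] with R hR hR₀
  have h_ratio : |y / (R * x)| ≤ 1 := by rwa [abs_div, div_le_one hR₀]
  rw [Real.norm_eq_abs, secondDiff_eq_mul (abs_pos.1 hR₀), abs_mul,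
    abs_of_nonneg (Real.rpow_nonneg hR₀.le α)]
  calc |R * x| ^ α * |secondDiff α 1 (y / (R * x))|
      ≤ |R * x| ^ α * (2 * |y / (R * x)| ^ q) := by
        gcongr
        exact h_bound _ h_ratio
    _ = 2 * |y| ^ q * |R * x| ^ (-(q - α)) := by
        rw [abs_div, Real.div_rpow (abs_nonneg _) hR₀.le, neg_sub, Real.rpow_sub hR₀]
        ring

end SecondDifference

section SecondDifferenceIntegral

lemma tendsto_integral_secondDiff {X : Type*} [MeasurableSpace X] {μ : Measure X} {α : ℝ}
    (hα₀ : 0 < α) (hα₂ : α < 2) {f g : X → ℝ} (hf : Measurable f) (hg : Measurable g)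
    (h_int : Integrable (fun x => |g x| ^ α) μ) :
    Filter.Tendsto (fun R : ℕ => ∫ x, secondDiff α (R * f x) (g x) ∂μ) Filter.atTop
      (𝓝 (∫ x in {x | f x = 0}, 2 * |g x| ^ α ∂μ)) := by
  rw [← integral_indicator (measurableSet_eq_fun hf measurable_const)]
  refine tendsto_integral_of_dominated_convergence (fun x => 8 * |g x| ^ α) (fun R => ?_)
    (h_int.const_mul 8) (fun R => ae_of_all _ fun x => abs_secondDiff_le hα₀ hα₂ _ _)
    (ae_of_all _ fun x => ?_)
  · unfold secondDiff
    exact Measurable.aestronglyMeasurable (by fun_prop)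
  · by_cases h : f x = 0
    · simp only [h, mul_zero, secondDiff_zero_left hα₀.ne', Set.indicator, Set.mem_ofPred_eq,
        if_true, tendsto_const_nhds]
    · simpa only [Set.indicator, Set.mem_ofPred_eq, h, if_false]
        using tendsto_secondDiff_atTop hα₀.le hα₂ h (g x)

variable {E : Type*} [NormedAddCommGroup E] [InnerProductSpace ℝ E] [MeasurableSpace E] {α : ℝ}
  {Γ N : Measure E}

lemma integral_secondDiff_inner (h : ∀ u : E, Integrable (fun s => |⟪u, s⟫_ℝ| ^ α) Γ) (v w : E) :
    Integrable (fun s => secondDiff α ⟪v, s⟫_ℝ ⟪w, s⟫_ℝ) Γ ∧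
    ∫ s, secondDiff α ⟪v, s⟫_ℝ ⟪w, s⟫_ℝ ∂Γ =
      ∫ s, |⟪v + w, s⟫_ℝ| ^ α ∂Γ + ∫ s, |⟪v - w, s⟫_ℝ| ^ α ∂Γ - 2 * ∫ s, |⟪v, s⟫_ℝ| ^ α ∂Γ := by
  simp only [secondDiff, ← inner_add_left, ← inner_sub_left]
  have h_add : Integrable (fun s => |⟪v + w, s⟫_ℝ| ^ α + |⟪v - w, s⟫_ℝ| ^ α) Γ :=
    (h (v + w)).add (h (v - w))
  have h_two := (h v).const_mul 2
  refine ⟨h_add.sub h_two, ?_⟩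
  rw [← integral_const_mul, ← integral_add (h _) (h _), ← integral_sub h_add h_two]

lemma HaveSameAbsMoments.integral_secondDiff_eq (h : HaveSameAbsMoments α Γ N) (v w : E) :
    ∫ s, secondDiff α ⟪v, s⟫_ℝ ⟪w, s⟫_ℝ ∂Γ = ∫ s, secondDiff α ⟪v, s⟫_ℝ ⟪w, s⟫_ℝ ∂N := by
  rw [(integral_secondDiff_inner h.integrable_left v w).2,
    (integral_secondDiff_inner h.integrable_right v w).2, h.integral_eq, h.integral_eq,
    h.integral_eq]

lemma HaveSameAbsMoments.lintegral_abs_sub_abs_eq (h : HaveSameAbsMoments 1 Γ N) (v w : E) :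
    ∫⁻ s, ENNReal.ofReal (|⟪w, s⟫_ℝ| - |⟪v, s⟫_ℝ|) ∂Γ =
      ∫⁻ s, ENNReal.ofReal (|⟪w, s⟫_ℝ| - |⟪v, s⟫_ℝ|) ∂N := by
  have h_pos_part : ∀ {M : Measure E}, (∀ u : E, Integrable (fun s => |⟪u, s⟫_ℝ| ^ (1 : ℝ)) M) →
      ∫⁻ s, ENNReal.ofReal (|⟪w, s⟫_ℝ| - |⟪v, s⟫_ℝ|) ∂M =
        ENNReal.ofReal (∫ s, 1 / 2 * secondDiff 1 ⟪v, s⟫_ℝ ⟪w, s⟫_ℝ ∂M) := fun hM => by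
    rw [ofReal_integral_eq_lintegral_ofReal
      ((integral_secondDiff_inner hM v w).1.const_mul _)]
    · simp [secondDiff_one, ENNReal.ofReal_max]
    · exact ae_of_all _ fun s => by simp [secondDiff_one]
  rw [h_pos_part h.integrable_left, h_pos_part h.integrable_right, integral_const_mul,
    integral_const_mul, h.integral_secondDiff_eq]

end SecondDifferenceIntegral

section WeightedMeasure

variable {E F : Type*} [NormedAddCommGroup E] [InnerProductSpace ℝ E] [MeasurableSpace E]
  [NormedAddCommGroup F] [InnerProductSpace ℝ F] {α : ℝ} {Γ N : Measure E} {w : E}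

/-- The measure with density `|⟪w, ·⟫| ^ α` with respect to `Γ`. It is finite when `⟪w, ·⟫` has a
moment of order `α`, so that Fubini's theorem applies to it even if `Γ` is not σ-finite. -/
noncomputable def weightedMeasure (Γ : Measure E) (α : ℝ) (w : E) : Measure E :=
  Γ.withDensity fun s => ENNReal.ofReal (|⟪w, s⟫_ℝ| ^ α)

lemma isFiniteMeasure_weightedMeasure (h : Integrable (fun s => |⟪w, s⟫_ℝ| ^ α) Γ) :
    IsFiniteMeasure (weightedMeasure Γ α w) :=
  isFiniteMeasure_withDensity h.lintegral_lt_top.ne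

variable [BorelSpace E]

lemma lintegral_weightedMeasure {f : E → ℝ≥0∞} (hf : Measurable f) :
    ∫⁻ s, f s ∂weightedMeasure Γ α w = ∫⁻ s, ENNReal.ofReal (|⟪w, s⟫_ℝ| ^ α) * f s ∂Γ :=
  lintegral_withDensity_eq_lintegral_mul _
    ((continuous_const.inner continuous_id).measurable.abs.pow_const α).ennreal_ofReal hf

lemma ae_weightedMeasure_iff (hα : α ≠ 0) {P : E → Prop} :
    (∀ᵐ s ∂weightedMeasure Γ α w, P s) ↔ ∀ᵐ s ∂Γ, ⟪w, s⟫_ℝ ≠ 0 → P s := by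
  have h_meas : Measurable fun s => ENNReal.ofReal (|⟪w, s⟫_ℝ| ^ α) :=
    ((continuous_const.inner continuous_id).measurable.abs.pow_const α).ennreal_ofReal
  rw [weightedMeasure, ae_withDensity_iff h_meas]
  simp only [Ne, ENNReal.ofReal_eq_zero, (Real.rpow_nonneg (abs_nonneg _) α).ge_iff_eq',
    Real.rpow_eq_zero (abs_nonneg _) hα, abs_eq_zero]

variable [FiniteDimensional ℝ F] [MeasurableSpace F] [BorelSpace F]

lemma ae_stdGaussian_inner_ne_zero (hα : α ≠ 0) (h_int : Integrable (fun s => |⟪w, s⟫_ℝ| ^ α) Γ)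
    (T : E →L[ℝ] F) (hT : ∀ᵐ s ∂Γ, T s ≠ 0) :
    ∀ᵐ v ∂stdGaussian F, ∀ᵐ s ∂Γ, ⟪v, T s⟫_ℝ = 0 → ⟪w, s⟫_ℝ = 0 := by
  have := isFiniteMeasure_weightedMeasure h_int
  have h_meas : MeasurableSet {q : F × E | ⟪q.1, T q.2⟫_ℝ = 0} :=
    measurableSet_eq_fun (by fun_prop) measurable_const
  have h_null : (stdGaussian F).prod (weightedMeasure Γ α w) {q | ⟪q.1, T q.2⟫_ℝ = 0} = 0 := by
    rw [Measure.prod_apply_symm h_meas,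
      lintegral_eq_zero_iff (measurable_measure_prodMk_right h_meas)]
    filter_upwards [(ae_weightedMeasure_iff hα).2 (hT.mono fun s hs _ => hs)] with s hs
    exact stdGaussian_inner_eq_zero hs
  filter_upwards [Measure.measure_ae_null_of_prod_null h_null] with v hv
  have h_ae : ∀ᵐ s ∂weightedMeasure Γ α w, ⟪v, T s⟫_ℝ ≠ 0 := by
    rw [ae_iff]
    simpa using hv
  exact ((ae_weightedMeasure_iff hα).1 h_ae).mono fun s hs => not_imp_not.1 hs

-- For generic `v`, the functional `⟪v, T ·⟫` vanishes nowhere `Γ`-a.e., so the second differences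
-- at the points `R * ⟪v, T ·⟫` isolate the part of `N` on the kernel of `T` as `R → ∞`.
theorem HaveSameAbsMoments.ae_inner_eq_zero [CompleteSpace E] (h : HaveSameAbsMoments α Γ N)
    (hα₀ : 0 < α) (hα₂ : α < 2) (T : E →L[ℝ] F) (hT : ∀ᵐ s ∂Γ, T s ≠ 0) (w : E) :
    ∀ᵐ x ∂N, T x = 0 → ⟪w, x⟫_ℝ = 0 := by
  obtain ⟨v, hv⟩ := (ae_stdGaussian_inner_ne_zero hα₀.ne' (h.integrable_left w) T hT).exists
  have h_adjoint : ∀ (R : ℕ) s, R * ⟪v, T s⟫_ℝ = ⟪(R : ℝ) • T.adjoint v, s⟫_ℝ := fun R s => by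
    rw [inner_smul_left, ContinuousLinearMap.adjoint_inner_left, RCLike.conj_to_real]
  have hf : Measurable fun s => ⟪v, T s⟫_ℝ :=
    (continuous_const.inner T.continuous).measurable
  have hg : Measurable fun s => ⟪w, s⟫_ℝ := (continuous_const.inner continuous_id).measurable
  have h_limΓ := tendsto_integral_secondDiff hα₀ hα₂ hf hg (h.integrable_left w)
  have h_limN := tendsto_integral_secondDiff hα₀ hα₂ hf hg (h.integrable_right w)
  simp only [h_adjoint, h.integral_secondDiff_eq] at h_limΓ h_limN
  have h_zero : ∫ s in {s | ⟪v, T s⟫_ℝ = 0}, 2 * |⟪w, s⟫_ℝ| ^ α ∂Γ = 0 := by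
    refine setIntegral_eq_zero_of_ae_eq_zero ?_
    filter_upwards [hv] with s hs hvs
    rw [hs hvs, abs_zero, Real.zero_rpow hα₀.ne', mul_zero]
  rw [tendsto_nhds_unique h_limΓ h_limN, setIntegral_eq_zero_iff_of_nonneg_ae
    (ae_of_all _ fun s => by positivity) ((h.integrable_right w).const_mul 2).integrableOn,
    Filter.EventuallyEq, ae_restrict_iff' (measurableSet_eq_fun hf measurable_const)] at h_zero
  filter_upwards [h_zero] with x hx hTx
  simpa [hTx, Real.rpow_eq_zero (abs_nonneg _) hα₀.ne'] using hx

end WeightedMeasure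

/-! ### The logarithmic moment -/

section DyadicSums

lemma exists_le_two_pow_of_log (A : ℝ) : ∃ k : ℕ, A ≤ 2 ^ k ∧ (k : ℝ) ≤ 2 * |Real.log A| + 1 := by
  refine ⟨⌈2 * |Real.log A|⌉₊, ?_, (Nat.ceil_lt_add_one (by positivity)).le⟩
  have h_ceil : 2 * |Real.log A| ≤ ⌈2 * |Real.log A|⌉₊ := Nat.le_ceil _
  rw [← Real.exp_log (by positivity : (0 : ℝ) < 2 ^ ⌈2 * |Real.log A|⌉₊), Real.log_pow]
  refine (Real.le_exp_log A).trans (Real.exp_le_exp.2 ?_)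
  nlinarith [le_abs_self (Real.log A), Real.log_two_gt_d9, abs_nonneg (Real.log A)]

lemma tsum_ofReal_min_one_two_pow_le (A : ℝ) :
    ∑' i : ℕ, ENNReal.ofReal (min 1 ((1 / 2) ^ i * A)) ≤
      ENNReal.ofReal (3 + 2 * |Real.log A|) := by
  obtain ⟨k, hAk, hk⟩ := exists_le_two_pow_of_log A
  have h_head : ∑ i ∈ Finset.range k, ENNReal.ofReal (min 1 ((1 / 2) ^ i * A)) ≤ k := by
    refine (Finset.sum_le_card_nsmul _ _ 1 fun i _ => ?_).trans_eq (by simp)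
    exact ENNReal.ofReal_le_one.2 (min_le_left _ _)
  have h_tail : ∑' i : ℕ, ENNReal.ofReal (min 1 ((1 / 2) ^ (i + k) * A)) ≤ ENNReal.ofReal 2 := by
    have h_geom : ENNReal.ofReal 2 = ∑' i : ℕ, ENNReal.ofReal ((1 / 2) ^ i) := by
      rw [← ENNReal.ofReal_tsum_of_nonneg (fun i => by positivity) summable_geometric_two,
        tsum_geometric_two]
    rw [h_geom]
    refine ENNReal.tsum_le_tsum fun i => ENNReal.ofReal_le_ofReal ((min_le_right _ _).trans ?_)
    calc (1 / 2 : ℝ) ^ (i + k) * A ≤ (1 / 2) ^ (i + k) * 2 ^ k := by gcongr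
      _ = (1 / 2) ^ i := by rw [pow_add, mul_assoc, ← mul_pow]; norm_num
  rw [← Summable.sum_add_tsum_nat_add' (k := k) ENNReal.summable]
  refine (add_le_add h_head h_tail).trans ?_
  rw [← ENNReal.ofReal_natCast, ← ENNReal.ofReal_add k.cast_nonneg zero_le_two]
  exact ENNReal.ofReal_le_ofReal (by linarith)

lemma exists_two_pow_mul_le_of_log {A B : ℝ} (hB : 0 < B) (hAB : B < A) :
    ∃ k : ℕ, 2 ^ k * B ≤ A ∧ Real.log (A / B) ≤ k + 1 := by
  have h_log : 0 < Real.log (A / B) := Real.log_pos ((one_lt_div hB).2 hAB)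
  refine ⟨⌊Real.log (A / B)⌋₊, ?_, (Nat.lt_floor_add_one _).le⟩
  rw [← le_div_iff₀ hB, ← Real.log_le_log_iff (by positivity) (div_pos (hB.trans hAB) hB),
    Real.log_pow]
  refine le_trans ?_ (Nat.floor_le h_log.le)
  exact mul_le_of_le_one_right (Nat.cast_nonneg _) (by linarith [Real.log_two_lt_d9])

lemma ofReal_mul_log_sub_le {A B : ℝ} (hA : 0 ≤ A) (hB : 0 < B) :
    ENNReal.ofReal (A * Real.log (A / B) - A) ≤ 2 * ∑' i : ℕ, ENNReal.ofReal (A - 2 ^ i * B) := by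
  rcases le_or_gt A B with hAB | hAB
  · have h_log : Real.log (A / B) ≤ 0 :=
      Real.log_nonpos (by positivity) ((div_le_one hB).2 hAB)
    rw [ENNReal.ofReal_of_nonpos (by linarith [mul_nonpos_of_nonneg_of_nonpos hA h_log])]
    exact zero_le
  obtain ⟨k, h_pow, h_log⟩ := exists_two_pow_mul_le_of_log hB hAB
  have h_term : ∀ i ∈ Finset.range k,
      ENNReal.ofReal (A / 2) ≤ ENNReal.ofReal (A - 2 ^ i * B) := fun i hi => by
    have h_mono : (2 : ℝ) ^ (i + 1) * B ≤ 2 ^ k * B := by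
      gcongr
      exacts [one_le_two, Finset.mem_range.1 hi]
    rw [pow_succ] at h_mono
    exact ENNReal.ofReal_le_ofReal (by linarith)
  calc ENNReal.ofReal (A * Real.log (A / B) - A) ≤ ENNReal.ofReal (2 * (k * (A / 2))) :=
        ENNReal.ofReal_le_ofReal (by nlinarith [mul_le_mul_of_nonneg_left h_log hA])
    _ = 2 * ∑ i ∈ Finset.range k, ENNReal.ofReal (A / 2) := by
        rw [ENNReal.ofReal_mul zero_le_two, ENNReal.ofReal_mul k.cast_nonneg, Finset.sum_const,
          Finset.card_range, nsmul_eq_mul, ENNReal.ofReal_natCast, ENNReal.ofReal_ofNat]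
    _ ≤ 2 * ∑ i ∈ Finset.range k, ENNReal.ofReal (A - 2 ^ i * B) := by
        gcongr 2 * ?_
        exact Finset.sum_le_sum h_term
    _ ≤ 2 * ∑' i : ℕ, ENNReal.ofReal (A - 2 ^ i * B) := by
        gcongr
        exact ENNReal.sum_le_tsum _

end DyadicSums

section GaussianSlabs

lemma lintegral_tsum_measure_prodMk_comm {X Y ι : Type*} [MeasurableSpace X] [MeasurableSpace Y]
    [Countable ι] {μ : Measure X} {ν : Measure Y} [SFinite μ] [SFinite ν] {A : ι → Set (X × Y)}
    (hA : ∀ i, MeasurableSet (A i)) :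
    ∫⁻ x, ∑' i, ν (Prod.mk x ⁻¹' A i) ∂μ = ∫⁻ y, ∑' i, μ ((fun x => (x, y)) ⁻¹' A i) ∂ν := by
  rw [lintegral_tsum fun i => (measurable_measure_prodMk_left (hA i)).aemeasurable,
    lintegral_tsum fun i => (measurable_measure_prodMk_right (hA i)).aemeasurable]
  simp only [← Measure.prod_apply (hA _), ← Measure.prod_apply_symm (hA _)]

variable {E F : Type*} [NormedAddCommGroup E] [InnerProductSpace ℝ E] [MeasurableSpace E]
  [BorelSpace E] [NormedAddCommGroup F] [InnerProductSpace ℝ F] {Γ : Measure E} {w : E} {δ : ℝ}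

lemma lintegral_log_div_weightedMeasure_lt_top (h_int : Integrable (fun s => |⟪w, s⟫_ℝ|) Γ)
    (h_log : Integrable (fun s => |⟪w, s⟫_ℝ| * |Real.log ⟪w, s⟫_ℝ|) Γ) (hδ : δ ≠ 0) :
    ∫⁻ s, ENNReal.ofReal (3 + 2 * |Real.log (|⟪w, s⟫_ℝ| / δ)|) ∂weightedMeasure Γ 1 w < ∞ := by
  have hw : Measurable fun s => ⟪w, s⟫_ℝ := (continuous_const.inner continuous_id).measurable
  rw [lintegral_weightedMeasure (by fun_prop)]
  refine lt_of_le_of_lt (lintegral_mono fun s => ?_)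
    ((h_int.const_mul (3 + 2 * |Real.log δ|)).add (h_log.const_mul 2)).lintegral_lt_top
  rw [Real.rpow_one, ← ENNReal.ofReal_mul (abs_nonneg _), Pi.add_apply]
  refine ENNReal.ofReal_le_ofReal ?_
  rcases eq_or_ne ⟪w, s⟫_ℝ 0 with h_zero | h_zero
  · simp [h_zero]
  · rw [Real.log_div (abs_ne_zero.2 h_zero) hδ, Real.log_abs]
    nlinarith [mul_le_mul_of_nonneg_left (abs_sub (Real.log ⟪w, s⟫_ℝ) (Real.log δ))
      (abs_nonneg ⟪w, s⟫_ℝ)]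

lemma lintegral_abs_inner_sub_le_weightedMeasure {b : E → ℝ} (hb : Measurable b)
    (hb₀ : ∀ s, 0 ≤ b s) :
    ∫⁻ s, ENNReal.ofReal (|⟪w, s⟫_ℝ| - b s) ∂Γ ≤ weightedMeasure Γ 1 w {s | b s < |⟪w, s⟫_ℝ|} := by
  have h_meas : MeasurableSet {s | b s < |⟪w, s⟫_ℝ|} :=
    measurableSet_lt hb (continuous_const.inner continuous_id).measurable.abs
  rw [← lintegral_indicator_one h_meas,
    lintegral_weightedMeasure (measurable_one.indicator h_meas)]
  refine lintegral_mono fun s => ?_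
  by_cases hs : b s < |⟪w, s⟫_ℝ|
  · simpa [Set.indicator, hs] using hb₀ s
  · simp [Set.indicator, hs, not_lt.1 hs]

variable [FiniteDimensional ℝ F] [MeasurableSpace F] [BorelSpace F]

lemma tsum_stdGaussian_slab_le {y : F} (hδ : 0 < δ) (hy : δ ≤ ‖y‖) {b : ℝ} (hb : 0 ≤ b) :
    ∑' i : ℕ, stdGaussian F {v | 2 ^ i * |⟪v, y⟫_ℝ| < b} ≤
      ENNReal.ofReal (3 + 2 * |Real.log (b / δ)|) := by
  refine (ENNReal.tsum_le_tsum fun i => ?_).trans (tsum_ofReal_min_one_two_pow_le (b / δ))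
  rw [ENNReal.ofReal_min, ENNReal.ofReal_one]
  refine le_min prob_le_one ?_
  have h_slab : {v : F | 2 ^ i * |⟪v, y⟫_ℝ| < b} = {v : F | |⟪v, y⟫_ℝ| < (1 / 2) ^ i * b} := by
    ext v
    simp only [Set.mem_ofPred_eq]
    rw [one_div, inv_pow, ← div_eq_inv_mul, lt_div_iff₀' (by positivity)]
  rw [h_slab]
  refine (stdGaussian_abs_inner_lt_le (norm_pos_iff.1 (hδ.trans_le hy)) (by positivity)).trans
    (ENNReal.ofReal_le_ofReal ?_)
  rw [mul_div_assoc]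
  gcongr

lemma exists_tsum_lintegral_sub_ne_top [SecondCountableTopology E]
    (h_int : Integrable (fun s => |⟪w, s⟫_ℝ|) Γ)
    (h_log : Integrable (fun s => |⟪w, s⟫_ℝ| * |Real.log ⟪w, s⟫_ℝ|) Γ) (T : E →L[ℝ] F)
    (hδ : 0 < δ) (hT : ∀ᵐ s ∂Γ, δ ≤ ‖T s‖) :
    ∃ v : F, ∑' i : ℕ, ∫⁻ s, ENNReal.ofReal (|⟪w, s⟫_ℝ| - 2 ^ i * |⟪v, T s⟫_ℝ|) ∂Γ ≠ ∞ := by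
  have := isFiniteMeasure_weightedMeasure (α := 1) (by simpa only [Real.rpow_one] using h_int)
  let slab : ℕ → Set (F × E) := fun i => {q | 2 ^ i * |⟪q.1, T q.2⟫_ℝ| < |⟪w, q.2⟫_ℝ|}
  have h_slab : ∀ i, MeasurableSet (slab i) := fun i =>
    measurableSet_lt (by fun_prop) (by fun_prop)
  have h_fin : ∫⁻ v, ∑' i, weightedMeasure Γ 1 w (Prod.mk v ⁻¹' slab i) ∂stdGaussian F < ∞ := by
    rw [lintegral_tsum_measure_prodMk_comm h_slab]
    refine (lintegral_mono_ae ?_).trans_lt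
      (lintegral_log_div_weightedMeasure_lt_top h_int h_log hδ.ne')
    filter_upwards [(ae_weightedMeasure_iff one_ne_zero).2 (hT.mono fun s hs _ => hs)] with s hs
    exact tsum_stdGaussian_slab_le hδ hs (abs_nonneg _)
  obtain ⟨v, hv⟩ := (ae_lt_top' (AEMeasurable.tsum fun i =>
    (measurable_measure_prodMk_left (h_slab i)).aemeasurable) h_fin.ne).exists
  refine ⟨v, ne_top_of_le_ne_top hv.ne (ENNReal.tsum_le_tsum fun i => ?_)⟩
  exact lintegral_abs_inner_sub_le_weightedMeasure
    (by fun_prop) fun s => by positivity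

end GaussianSlabs

section LogarithmicMoment

lemma mul_abs_log_div_le {r t y g K M : ℝ} (hr : 0 < r) (ht : 0 < t) (hK : 1 ≤ K) (hg : 0 ≤ g)
    (hry : r ≤ K * y) (htr : t ≤ M * r) (h : y * Real.log (y / t) ≤ g) :
    r * |Real.log (t / r)| ≤ K * g + (Real.log K + 2 * |Real.log M|) * r := by
  have hy : 0 < y := pos_of_mul_pos_right (hr.trans_le hry) (by linarith)
  have : 0 < M := pos_of_mul_pos_left (ht.trans_le htr) hr.le
  have h_lower : Real.log (t / r) ≤ |Real.log M| :=
    (Real.log_le_log (by positivity) ((div_le_iff₀ hr).2 htr)).trans (le_abs_self _)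
  have h_upper : -Real.log (t / r) ≤ Real.log K + Real.log (y / t) := by
    rw [← Real.log_inv, inv_div, ← Real.log_mul (by positivity) (by positivity), ← mul_div_assoc]
    exact Real.log_le_log (by positivity) (by gcongr)
  have h_abs : |Real.log (t / r)| ≤ Real.log K + Real.log (y / t) + 2 * |Real.log M| :=
    abs_le.2 ⟨by linarith [abs_nonneg (Real.log M)], by linarith⟩
  have h_main : r * Real.log (y / t) ≤ K * g := by
    rcases le_or_gt (Real.log (y / t)) 0 with h_sign | h_sign
    · exact (mul_nonpos_of_nonneg_of_nonpos hr.le h_sign).trans (by positivity)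
    · calc r * Real.log (y / t) ≤ K * y * Real.log (y / t) := by gcongr
        _ ≤ K * g := by
          rw [mul_assoc]
          gcongr
  linarith [mul_le_mul_of_nonneg_left h_abs hr.le]

variable {E F ι : Type*} [NormedAddCommGroup E] [InnerProductSpace ℝ E] [NormedAddCommGroup F]
  [InnerProductSpace ℝ F]

lemma mul_log_div_le_toReal_tsum {w x : E} {v y : F} (hy : y ≠ 0)
    (h_fin : ∑' i : ℕ, ENNReal.ofReal (|⟪w, x⟫_ℝ| - 2 ^ i * |⟪v, y⟫_ℝ|) ≠ ∞) :
    |⟪w, x⟫_ℝ| * Real.log (|⟪w, x⟫_ℝ| / ‖y‖) ≤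
      2 * (∑' i : ℕ, ENNReal.ofReal (|⟪w, x⟫_ℝ| - 2 ^ i * |⟪v, y⟫_ℝ|)).toReal +
        ‖w‖ * (1 + |Real.log (‖v‖ + 1)|) * ‖x‖ := by
  have hy₀ : 0 < ‖y‖ := norm_pos_iff.2 hy
  have h_inner : |⟪v, y⟫_ℝ| ≤ (‖v‖ + 1) * ‖y‖ := by
    linarith [abs_real_inner_le_norm v y]
  rcases eq_or_ne ⟪w, x⟫_ℝ 0 with h_zero | h_zero
  · rw [h_zero, abs_zero, zero_mul]
    positivity
  have h_dyadic : |⟪w, x⟫_ℝ| * Real.log (|⟪w, x⟫_ℝ| / ((‖v‖ + 1) * ‖y‖)) - |⟪w, x⟫_ℝ| ≤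
      2 * (∑' i : ℕ, ENNReal.ofReal (|⟪w, x⟫_ℝ| - 2 ^ i * |⟪v, y⟫_ℝ|)).toReal := by
    have h_sum := (ofReal_mul_log_sub_le (abs_nonneg ⟪w, x⟫_ℝ)
      (by positivity : 0 < (‖v‖ + 1) * ‖y‖)).trans (by gcongr :
        _ ≤ 2 * ∑' i : ℕ, ENNReal.ofReal (|⟪w, x⟫_ℝ| - 2 ^ i * |⟪v, y⟫_ℝ|))
    simpa only [ENNReal.toReal_mul, ENNReal.toReal_ofNat] using
      (ENNReal.ofReal_le_iff_le_toReal (ENNReal.mul_ne_top ENNReal.ofNat_ne_top h_fin)).1 h_sum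
  have h_log : Real.log (|⟪w, x⟫_ℝ| / ((‖v‖ + 1) * ‖y‖)) =
      Real.log (|⟪w, x⟫_ℝ| / ‖y‖) - Real.log (‖v‖ + 1) := by
    rw [mul_comm, ← div_div, Real.log_div (by positivity) (by positivity)]
  rw [h_log] at h_dyadic
  have h_abs := mul_le_mul_of_nonneg_left (le_abs_self (Real.log (‖v‖ + 1)))
    (abs_nonneg ⟪w, x⟫_ℝ)
  have h_norm := mul_le_mul_of_nonneg_right (abs_real_inner_le_norm w x)
    (by positivity : 0 ≤ 1 + |Real.log (‖v‖ + 1)|)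
  linarith

variable [CompleteSpace E] [SecondCountableTopology E] [MeasurableSpace E] [BorelSpace E]
  [FiniteDimensional ℝ F] {a δ : ℝ} {c : ι → E} {Γ : Measure E} {w : E}

lemma HaveSameAbsMoments.exists_tsum_ofReal_sub_ne_top
    (h : HaveSameAbsMoments 1 Γ (atomicMeasure (fun _ => a) c)) (ha : 0 < a)
    (h_log : Integrable (fun s => |⟪w, s⟫_ℝ| * |Real.log ⟪w, s⟫_ℝ|) Γ) (T : E →L[ℝ] F)
    (hδ : 0 < δ) (hT : ∀ᵐ s ∂Γ, δ ≤ ‖T s‖) :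
    ∃ v : F, ∑' (k : ι) (i : ℕ), ENNReal.ofReal (|⟪w, c k⟫_ℝ| - 2 ^ i * |⟪v, T (c k)⟫_ℝ|) ≠ ∞ := by
  borelize F
  have h_int : Integrable (fun s => |⟪w, s⟫_ℝ|) Γ := by
    simpa only [Real.rpow_one] using h.integrable_left w
  obtain ⟨v, hv⟩ := exists_tsum_lintegral_sub_ne_top h_int h_log T hδ hT
  have h_transfer : ∀ i : ℕ, ∫⁻ s, ENNReal.ofReal (|⟪w, s⟫_ℝ| - 2 ^ i * |⟪v, T s⟫_ℝ|) ∂Γ =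
      ∑' k, ENNReal.ofReal a *
        ENNReal.ofReal (|⟪w, c k⟫_ℝ| - 2 ^ i * |⟪v, T (c k)⟫_ℝ|) := fun i => by
    have h_adjoint : ∀ s, 2 ^ i * |⟪v, T s⟫_ℝ| = |⟪(2 : ℝ) ^ i • T.adjoint v, s⟫_ℝ| := fun s => by
      rw [inner_smul_left, ContinuousLinearMap.adjoint_inner_left, RCLike.conj_to_real, abs_mul,
        abs_of_pos (by positivity : (0 : ℝ) < 2 ^ i)]
    simp only [h_adjoint]
    rw [h.lintegral_abs_sub_abs_eq, lintegral_atomicMeasure (by fun_prop)]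
  refine ⟨v, fun h_top => hv ?_⟩
  simp only [h_transfer]
  rw [ENNReal.tsum_comm]
  simp only [ENNReal.tsum_mul_left, h_top, ENNReal.mul_top (ENNReal.ofReal_pos.2 ha).ne']

lemma HaveSameAbsMoments.exists_summable_bound_mul_log_div
    (h : HaveSameAbsMoments 1 Γ (atomicMeasure (fun _ => a) c)) (ha : 0 < a)
    (hc : Summable fun i => ‖c i‖)
    (h_log : Integrable (fun s => |⟪w, s⟫_ℝ| * |Real.log ⟪w, s⟫_ℝ|) Γ) (T : E →L[ℝ] F)
    (hδ : 0 < δ) (hT : ∀ᵐ s ∂Γ, δ ≤ ‖T s‖) :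
    ∃ g : ι → ℝ, (∀ i, 0 ≤ g i) ∧ Summable g ∧ ∀ i, T (c i) ≠ 0 →
      |⟪w, c i⟫_ℝ| * Real.log (|⟪w, c i⟫_ℝ| / ‖T (c i)‖) ≤ g i := by
  obtain ⟨v, hv⟩ := h.exists_tsum_ofReal_sub_ne_top ha h_log T hδ hT
  exact ⟨_, fun k => by positivity, ((ENNReal.summable_toReal hv).mul_left 2).add (hc.mul_left _),
    fun k hk => mul_log_div_le_toReal_tsum hk (ENNReal.ne_top_of_tsum_ne_top hv k)⟩

end LogarithmicMoment

theorem HaveSameAbsMoments.summable_norm_mul_log_div {F ι κ : Type*} [NormedAddCommGroup F]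
    [InnerProductSpace ℝ F] [FiniteDimensional ℝ F] [Fintype κ] {a δ : ℝ}
    {c : ι → EuclideanSpace ℝ κ} {Γ : Measure (EuclideanSpace ℝ κ)}
    (h : HaveSameAbsMoments 1 Γ (atomicMeasure (fun _ => a) c)) (ha : 0 < a)
    (hc : Summable fun i => ‖c i‖)
    (h_log : ∀ u, Integrable (fun s => |⟪u, s⟫_ℝ| * |Real.log ⟪u, s⟫_ℝ|) Γ)
    (T : EuclideanSpace ℝ κ →L[ℝ] F) (hδ : 0 < δ) (hT : ∀ᵐ s ∂Γ, δ ≤ ‖T s‖)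
    (hTc : ∀ i, T (c i) = 0 → c i = 0) :
    Summable fun i => ‖c i‖ * |Real.log (‖T (c i)‖ / ‖c i‖)| := by
  classical
  rcases isEmpty_or_nonempty κ with hκ | hκ
  · simp [Subsingleton.elim _ (0 : EuclideanSpace ℝ κ), summable_zero]
  choose g hg₀ hg_sum hg using fun j : κ =>
    h.exists_summable_bound_mul_log_div ha hc (h_log (EuclideanSpace.single j 1)) T hδ hT
  simp only [EuclideanSpace.inner_single_left, map_one, one_mul] at hg
  refine Summable.of_nonneg_of_le (fun i => by positivity) (fun i => ?_)
    (((summable_sum fun j (_ : j ∈ Finset.univ) => hg_sum j).mul_left (Fintype.card κ : ℝ)).add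
      (hc.mul_left (Real.log (Fintype.card κ) + 2 * |Real.log ‖T‖|)))
  have h_card : (1 : ℝ) ≤ Fintype.card κ := by exact_mod_cast Fintype.card_pos (α := κ)
  by_cases h_zero : c i = 0
  · have h_nonneg : 0 ≤ ∑ j, g j i := Finset.sum_nonneg fun j _ => hg₀ j i
    rw [h_zero, norm_zero, zero_mul, mul_zero, add_zero]
    positivity
  have hTci : T (c i) ≠ 0 := fun hT₀ => h_zero (hTc i hT₀)
  obtain ⟨j, hj⟩ := exists_norm_le_card_mul_abs (c i)
  have h_single : g j i ≤ ∑ j, g j i :=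
    Finset.single_le_sum (f := fun j => g j i) (fun j _ => hg₀ j i) (Finset.mem_univ j)
  exact mul_abs_log_div_le (norm_pos_iff.2 h_zero) (norm_pos_iff.2 hTci) h_card
    ((hg₀ j i).trans h_single) hj (T.le_opNorm _) ((hg j i hTci).trans h_single)

/-! ### Representability of stable series -/

section SeminormKernel

variable {E : Type*} [AddCommGroup E] [Module ℝ E]

/-- The kernel of a seminorm, as a submodule, so that one can project orthogonally along it. -/
def seminormKer (p : Seminorm ℝ E) : Submodule ℝ E where
  carrier := {x | p x = 0}
  add_mem' {x y} hx hy :=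
    le_antisymm ((map_add_le_add p x y).trans_eq (by rw [hx, hy, add_zero])) (apply_nonneg p _)
  zero_mem' := map_zero p
  smul_mem' r x hx := by rw [Set.mem_ofPred_eq, map_smul_eq_mul, hx, mul_zero]

variable {p q : Seminorm ℝ E}

lemma mem_seminormKer {x : E} : x ∈ seminormKer p ↔ p x = 0 := Iff.rfl

lemma seminorm_eq_of_sub_mem_seminormKer {x y : E} (h : x - y ∈ seminormKer p) : p x = p y := by
  have h_abs := abs_sub_map_le_sub p x y
  rw [mem_seminormKer.1 h] at h_abs
  exact sub_eq_zero.1 (abs_nonpos_iff.1 h_abs)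

end SeminormKernel

section SeminormComparison

variable {E : Type*} [NormedAddCommGroup E] [InnerProductSpace ℝ E] [FiniteDimensional ℝ E]
  {p q : Seminorm ℝ E}

lemma sub_starProjection_orthogonal_mem_seminormKer (x : E) :
    x - (seminormKer p)ᗮ.starProjection x ∈ seminormKer p := by
  simpa only [Submodule.orthogonal_orthogonal] using
    (seminormKer p)ᗮ.sub_starProjection_mem_orthogonal x

lemma starProjection_orthogonal_seminormKer_eq_zero_iff {x : E} :
    (seminormKer p)ᗮ.starProjection x = 0 ↔ p x = 0 := by
  rw [Submodule.starProjection_apply_eq_zero_iff, Submodule.orthogonal_orthogonal, mem_seminormKer]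

theorem exists_seminorm_le_mul (h : seminormKer p ≤ seminormKer q) :
    ∃ C, 0 < C ∧ ∀ x, q x ≤ C * p x := by
  have hp := p.convexOn.locallyLipschitz.continuous
  have hq := q.convexOn.locallyLipschitz.continuous
  have h_compact : IsCompact (Metric.sphere (0 : E) 1 ∩ (seminormKer p)ᗮ) :=
    (isCompact_sphere 0 1).inter_right (seminormKer p)ᗮ.closed_of_finiteDimensional
  have h_pos : ∀ x ∈ (seminormKer p)ᗮ, x ≠ 0 → 0 < p x := fun x hx hx₀ =>
    (apply_nonneg p x).lt_of_ne' fun hpx => hx₀ <| Submodule.disjoint_def.1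
      (seminormKer p).orthogonal_disjoint x (mem_seminormKer.2 hpx) hx
  obtain ⟨C, hC⟩ := h_compact.exists_bound_of_continuousOn (f := fun x => q x / p x)
    (hq.continuousOn.div hp.continuousOn fun x hx =>
      (h_pos x hx.2 (ne_zero_of_mem_unit_sphere ⟨x, hx.1⟩)).ne')
  refine ⟨|C| + 1, by positivity, fun x => ?_⟩
  have hx := sub_starProjection_orthogonal_mem_seminormKer (p := p) x
  rw [seminorm_eq_of_sub_mem_seminormKer hx, seminorm_eq_of_sub_mem_seminormKer (h hx)]
  set y := (seminormKer p)ᗮ.starProjection x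
  have hy_mem : y ∈ (seminormKer p)ᗮ := Submodule.starProjection_apply_mem _ x
  rcases eq_or_ne y 0 with h_zero | h_zero
  · simp [h_zero]
  have h_bound := hC (‖y‖⁻¹ • y) ⟨by simp [norm_smul, h_zero], Submodule.smul_mem _ _ hy_mem⟩
  rw [map_smul_eq_mul, map_smul_eq_mul, mul_div_mul_left _ _ (by simpa using h_zero),
    Real.norm_of_nonneg (by positivity), div_le_iff₀ (h_pos y hy_mem h_zero)] at h_bound
  exact h_bound.trans (by gcongr; linarith [le_abs_self C])

lemma exists_norm_starProjection_equiv (p : Seminorm ℝ E) :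
    ∃ C, 0 < C ∧ ∀ x, ‖(seminormKer p)ᗮ.starProjection x‖ ≤ C * p x ∧
      p x ≤ C * ‖(seminormKer p)ᗮ.starProjection x‖ := by
  set q : Seminorm ℝ E :=
    (normSeminorm ℝ E).comp (seminormKer p)ᗮ.starProjection.toLinearMap
  have h_ker : seminormKer q = seminormKer p := by
    ext x
    exact (norm_eq_zero (a := (seminormKer p)ᗮ.starProjection x)).trans
      starProjection_orthogonal_seminormKer_eq_zero_iff
  obtain ⟨C, hC, hqp⟩ := exists_seminorm_le_mul h_ker.ge
  obtain ⟨D, -, hpq⟩ := exists_seminorm_le_mul h_ker.le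
  refine ⟨max C D, lt_max_of_lt_left hC, fun x => ⟨(hqp x).trans ?_, (hpq x).trans ?_⟩⟩
  · gcongr
    exact le_max_left _ _
  · change D * ‖(seminormKer p)ᗮ.starProjection x‖ ≤ _
    gcongr
    exact le_max_right _ _

end SeminormComparison

section Necessity

lemma abs_log_div_le_add {x y z C : ℝ} (hx : 0 < x) (hy : 0 < y) (hz : 0 < z) (hxy : x ≤ C * y)
    (hyx : y ≤ C * x) : |Real.log (y / z)| ≤ |Real.log (x / z)| + Real.log C := by
  have hC : 0 < C := pos_of_mul_pos_left (hx.trans_le hxy) hy.le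
  have h_xy := Real.log_le_log hx hxy
  have h_yx := Real.log_le_log hy hyx
  rw [Real.log_mul hC.ne' hy.ne'] at h_xy
  rw [Real.log_mul hC.ne' hx.ne'] at h_yx
  have h_diff : |Real.log y - Real.log x| ≤ Real.log C := abs_le.2 ⟨by linarith, by linarith⟩
  rw [Real.log_div hy.ne' hz.ne', Real.log_div hx.ne' hz.ne']
  calc |Real.log y - Real.log z|
      = |(Real.log x - Real.log z) + (Real.log y - Real.log x)| := by ring_nf
    _ ≤ |Real.log x - Real.log z| + |Real.log y - Real.log x| := abs_add_le _ _
    _ ≤ _ := by gcongr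

variable {ι : Type*} {n : ℕ} {p : Seminorm ℝ (EuclideanSpace ℝ (Fin n))}
  {c : ι → EuclideanSpace ℝ (Fin n)} {α β a : ℝ} {Γ : Measure (EuclideanSpace ℝ (Fin n))}

lemma HaveSameAbsMoments.eq_zero_of_seminorm_eq_zero [Countable ι]
    (h : HaveSameAbsMoments α Γ (atomicMeasure (fun _ => a) c)) (hα₀ : 0 < α) (hα₂ : α < 2)
    (ha : 0 < a) (h_supp : Γ (unitCylinder p)ᶜ = 0) (i : ι) (hi : p (c i) = 0) : c i = 0 := by
  have hT : ∀ᵐ s ∂Γ, (seminormKer p)ᗮ.starProjection s ≠ 0 := by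
    filter_upwards [compl_mem_ae_iff.2 h_supp] with s hs h_zero
    rw [compl_compl, unitCylinder, Set.mem_ofPred_eq,
      starProjection_orthogonal_seminormKer_eq_zero_iff.1 h_zero] at hs
    exact zero_ne_one hs
  exact inner_self_eq_zero.1 <| of_ae_atomicMeasure (h.ae_inner_eq_zero hα₀ hα₂ _ hT (c i)) ha
    (starProjection_orthogonal_seminormKer_eq_zero_iff.2 hi)

theorem HaveSameAbsMoments.summable_norm_mul_log_seminorm_div
    (h : HaveSameAbsMoments 1 Γ (atomicMeasure (fun _ => a) c)) (ha : 0 < a)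
    (hc : Summable fun i => ‖c i‖)
    (h_log : ∀ u, Integrable (fun s => |⟪u, s⟫_ℝ| * |Real.log ⟪u, s⟫_ℝ|) Γ)
    (h_supp : Γ (unitCylinder p)ᶜ = 0) (hpc : ∀ i, p (c i) = 0 → c i = 0) :
    Summable fun i => ‖c i‖ * |Real.log (p (c i) / ‖c i‖)| := by
  obtain ⟨C, hC, h_equiv⟩ := exists_norm_starProjection_equiv p
  have hT : ∀ᵐ s ∂Γ, C⁻¹ ≤ ‖(seminormKer p)ᗮ.starProjection s‖ := by
    filter_upwards [compl_mem_ae_iff.2 h_supp] with s hs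
    rw [compl_compl, unitCylinder, Set.mem_ofPred_eq] at hs
    rw [inv_le_iff_one_le_mul₀' hC, ← hs]
    exact (h_equiv s).2
  have h_sum := h.summable_norm_mul_log_div ha hc h_log _ (inv_pos.2 hC) hT
    fun i hi => hpc i (starProjection_orthogonal_seminormKer_eq_zero_iff.1 hi)
  refine Summable.of_nonneg_of_le (fun i => by positivity) (fun i => ?_)
    (h_sum.add (hc.mul_right (Real.log C)))
  rcases eq_or_ne (c i) 0 with h_zero | h_zero
  · simp [h_zero]
  have hp_ne : p (c i) ≠ 0 := fun hp => h_zero (hpc i hp)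
  rw [← mul_add]
  gcongr
  exact abs_log_div_le_add
    (norm_pos_iff.2 fun hT₀ => hp_ne (starProjection_orthogonal_seminormKer_eq_zero_iff.1 hT₀))
    ((apply_nonneg p _).lt_of_ne' hp_ne) (norm_pos_iff.2 h_zero) (h_equiv _).1 (h_equiv _).2

end Necessity

section Representability

lemma summable_norm_mul_log_seminorm {ι E : Type*} [NormedAddCommGroup E] [Module ℝ E]
    {p : Seminorm ℝ E} {c : ι → E} (hpc : ∀ i, p (c i) = 0 → c i = 0)
    (h_log : Summable fun i => ‖c i‖ * |Real.log ‖c i‖|)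
    (h_ratio : Summable fun i => ‖c i‖ * |Real.log (p (c i) / ‖c i‖)|) :
    Summable fun i => ‖c i‖ * |Real.log (p (c i))| := by
  refine Summable.of_nonneg_of_le (fun i => by positivity) (fun i => ?_) (h_ratio.add h_log)
  rcases eq_or_ne (c i) 0 with h_zero | h_zero
  · simp [h_zero]
  rw [Real.log_div (fun hp => h_zero (hpc i hp)) (norm_ne_zero_iff.2 h_zero), ← mul_add]
  gcongr
  simpa only [sub_add_cancel] using
    abs_add_le (Real.log (p (c i)) - Real.log ‖c i‖) (Real.log ‖c i‖)

variable {ι : Type*} {n : ℕ} {p : Seminorm ℝ (EuclideanSpace ℝ (Fin n))}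
  {c : ι → EuclideanSpace ℝ (Fin n)} {α β a : ℝ} {law : Measure (EuclideanSpace ℝ (Fin n))}

lemma IsStableSeriesLaw.eq_zero_of_isRepresentable [Countable ι]
    (h : IsStableSeriesLaw α β a c law) (hα₀ : 0 < α) (hα₂ : α < 2) (ha : 0 < a)
    (h_rep : IsRepresentable α p law) (i : ι) (hi : p (c i) = 0) : c i = 0 := by
  by_cases h_symm : IsSymmetricMeasure law
  · obtain ⟨Γ, h_supp, h_mom⟩ := (h_rep.2 h_symm).exists_haveSameAbsMoments h hα₀.le ha.le
    exact h_mom.eq_zero_of_seminorm_eq_zero hα₀ hα₂ ha h_supp i hi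
  · obtain ⟨Γ, h_supp, h_mom, -⟩ := (h_rep.1 h_symm).exists_haveSameAbsMoments h hα₀.le ha.le
    exact h_mom.eq_zero_of_seminorm_eq_zero hα₀ hα₂ ha h_supp i hi

theorem IsStableSeriesLaw.isRepresentable_iff [Countable ι] (h : IsStableSeriesLaw α β a c law)
    (hα₀ : 0 < α) (hα₂ : α < 2) (hβ₁ : -1 ≤ β) (hβ₂ : β ≤ 1) (ha : 0 < a)
    (h_case : α ≠ 1 ∨ β = 0 ∨ IsSymmetricMeasure law) :
    IsRepresentable α p law ↔ ∀ i, p (c i) = 0 → c i = 0 := by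
  refine ⟨h.eq_zero_of_isRepresentable hα₀ hα₂ ha, fun hc => ⟨fun h_asymm => ?_, fun h_symm =>
    (h.zero_skewness hα₀ h_symm).isRepresentableSymm hα₀ ha.le hc⟩⟩
  have hα₁ : α ≠ 1 := by
    rcases h_case with hα₁ | rfl | h_symm
    · exact hα₁
    · exact absurd (h.isSymmetricMeasure hα₀.ne') h_asymm
    · exact absurd h_symm h_asymm
  refine h.isRepresentableAsymm hα₀ hβ₁ hβ₂ ha.le (fun hα => absurd hα hα₁) hc ?_
  simp only [logScale, hα₁, if_false, abs_zero, mul_zero, summable_zero]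

theorem IsStableSeriesLaw.isRepresentable_one_iff [Countable ι]
    (h : IsStableSeriesLaw 1 β a c law) (hβ₀ : β ≠ 0) (hβ₁ : -1 ≤ β) (hβ₂ : β ≤ 1) (ha : 0 < a)
    (h_asymm : ¬ IsSymmetricMeasure law) :
    IsRepresentable 1 p law ↔ (∀ i, p (c i) = 0 → c i = 0) ∧
      Summable fun i => ‖c i‖ * |Real.log (p (c i) / ‖c i‖)| := by
  constructor
  · intro h_rep
    have hc := h.eq_zero_of_isRepresentable one_pos one_lt_two ha h_rep
    obtain ⟨Γ, h_supp, h_mom, h_log⟩ :=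
      (h_rep.1 h_asymm).exists_haveSameAbsMoments h zero_le_one ha.le
    exact ⟨hc, h_mom.summable_norm_mul_log_seminorm_div ha (by simpa using h.summable_rpow)
      (h_log rfl) h_supp hc⟩
  · rintro ⟨hc, h_ratio⟩
    refine ⟨fun _ => h.isRepresentableAsymm one_pos hβ₁ hβ₂ ha.le (fun _ => hβ₀) hc ?_,
      fun h_symm => absurd h_symm h_asymm⟩
    simpa only [logScale, if_true] using
      summable_norm_mul_log_seminorm hc (h.summable_log rfl hβ₀) h_ratio

end Representability

/-! ### The gap condition -/

section InteriorGap

variable {d : ℤ → ℝ} {m h : ℕ}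

lemma seminorm_coeffVector_eq_zero_iff {p : Seminorm ℝ (EuclideanSpace ℝ (Fin (m + h + 1)))}
    (hp : ∀ x, p x = 0 ↔ ∀ j : Fin (m + h + 1), (j : ℕ) ≤ m → x j = 0) (k : ℤ) :
    p (coeffVector d m h k) = 0 ↔ ∀ i : ℤ, k ≤ i → i ≤ k + m → d i = 0 := by
  rw [hp]
  refine ⟨fun h_zero i hki hik => ?_, fun h_zero j hj => h_zero _ (by omega) (by omega)⟩
  have h_apply := h_zero ⟨(k + m - i).toNat, by omega⟩ (by simp; omega)
  simp only [coeffVector] at h_apply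
  rwa [Int.toNat_of_nonneg (by omega), sub_sub_cancel] at h_apply

-- A coefficient vector with vanishing head has `d (k - 1)` as its next entry, so the zeros
-- propagate downwards one step at a time.
lemma noInteriorGap_of_forall_coeffVector_eq_zero (hh : 1 ≤ h)
    (h_head : ∀ k, (∀ i : ℤ, k ≤ i → i ≤ k + m → d i = 0) → coeffVector d m h k = 0) :
    NoInteriorGap d m := by
  have h_pred : ∀ k : ℤ, (∀ i : ℤ, k ≤ i → i ≤ k + m → d i = 0) → d (k - 1) = 0 := by
    intro k hk
    have h_apply := congrArg (fun x : EuclideanSpace ℝ (Fin (m + h + 1)) => x ⟨m + 1, by omega⟩)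
      (h_head k hk)
    simp only [coeffVector, PiLp.zero_apply] at h_apply
    rwa [show k + m - ((m + 1 : ℕ) : ℤ) = k - 1 by push_cast; ring] at h_apply
  intro k hk l hl
  have h_all : ∀ N : ℕ, ∀ i : ℤ, k - N ≤ i → i ≤ k + m → d i = 0 := by
    intro N
    induction N with
    | zero => simpa using hk
    | succ N ih =>
      intro i hNi hik
      rcases eq_or_ne i (k - N - 1) with rfl | h_ne
      · exact h_pred (k - N) fun i hi hi' => ih i hi (by omega)
      · exact ih i (by push_cast at hNi; omega) hik
  exact h_all (k - l).toNat l (by omega) (by omega)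

lemma noInteriorGap_iff (hh : 1 ≤ h) {p : Seminorm ℝ (EuclideanSpace ℝ (Fin (m + h + 1)))}
    (hp : ∀ x, p x = 0 ↔ ∀ j : Fin (m + h + 1), (j : ℕ) ≤ m → x j = 0) :
    NoInteriorGap d m ↔ ∀ k, p (coeffVector d m h k) = 0 → coeffVector d m h k = 0 := by
  simp only [seminorm_coeffVector_eq_zero_iff hp]
  refine ⟨fun h_gap k hk => ?_, noInteriorGap_of_forall_coeffVector_eq_zero hh⟩
  ext j
  change d (k + m - (j : ℕ)) = 0
  by_cases hj : (j : ℕ) ≤ m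
  · exact hk _ (by omega) (by omega)
  · exact h_gap k hk _ (by omega)

end InteriorGap

theorem lemma1 {Ω : Type*} [MeasurableSpace Ω] (P : Measure Ω) [IsProbabilityMeasure P]
    (α β σ : ℝ) (hα₀ : 0 < α) (hα₂ : α < 2) (hβ₁ : -1 ≤ β) (hβ₂ : β ≤ 1) (hσ : 0 < σ)
    (ε : ℤ → Ω → ℝ) (hε : IsStableNoise P α β σ ε)
    (d : ℤ → ℝ) (hd : IsMACoeff α β d)
    (m h : ℕ) (hh : 1 ≤ h) (t : ℤ)
    (p : Seminorm ℝ (EuclideanSpace ℝ (Fin (m + h + 1))))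
    (hp : ∀ x, p x = 0 ↔ ∀ j : Fin (m + h + 1), (j : ℕ) ≤ m → x j = 0) :
    ((α ≠ 1 ∨ β = 0 ∨
        IsSymmetricMeasure (P.map (pathVector (movingAverage d ε) m h t))) →
      (IsRepresentable α p (P.map (pathVector (movingAverage d ε) m h t)) ↔
        NoInteriorGap d m)) ∧
    (α = 1 → β ≠ 0 →
      ¬ IsSymmetricMeasure (P.map (pathVector (movingAverage d ε) m h t)) →
      (IsRepresentable α p (P.map (pathVector (movingAverage d ε) m h t)) ↔
        NoInteriorGap d m ∧
        Summable fun k : ℤ => ‖coeffVector d m h k‖ *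
          |Real.log (p (coeffVector d m h k) / ‖coeffVector d m h k‖)|)) := by
  have h_law := isStableSeriesLaw_pathVector hε hd hα₀ hσ.le m h t
  have hσ_rpow : 0 < σ ^ α := Real.rpow_pos_of_pos hσ α
  rw [noInteriorGap_iff hh hp]
  refine ⟨h_law.isRepresentable_iff hα₀ hα₂ hβ₁ hβ₂ hσ_rpow, ?_⟩
  rintro rfl hβ₀ h_asymm
  exact h_law.isRepresentable_one_iff hβ₀ hβ₁ hβ₂ hσ_rpow h_asymm
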